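/- Let $d\ge 1$ and let $|\cdot|$ be the $1$-norm on $\mathbb Z^d$. Let $m_x$, $k_x$ ($x\in\mathbb Z^d$) and $\lambda_{x,y}=\lambda_{y,x}$ ($|x-y|=1$) be real random variables on a probability space $(\Omega,\mathbb P)$ such that, almost surely, $m_{\min}\le m_x\le m_{\max}$, $0\le k_x\le k_{\max}$ and $0\le\lambda_{x,y}\le\lambda_{\max}$ for all $x,y$, with deterministic constants and $m_{\min}>0$. For $L\ge 1$ put $\Lambda_L=[-L,L]^d\cap\mathbb Z^d$ and let $$H_L=\sum_{x\in\Lambda_L}\Big(\frac{1}{2m_x}p_x^2+\frac{k_x}{2}q_x^2\Big)+\sum_{\{x,y\}\subset\Lambda_L,\ |x-y|=1}\lambda_{x,y}(q_x-q_y)^2$$ be the closure in $L^2(\mathbb R^{\Lambda_L})$ of this operator on the Schwartz space, where $q_x$ is (the closure of) multiplication by the coordinate $q_x$ and $p_x$ is (the closure of) $-i\,\partial/\partial q_x$. Let $h_{0,L}$ be the real symmetric matrix indexed by $\Lambda_L$ with diagonal entries $\frac{k_x}{2}+\sum_{u\in\Lambda_L,\,|u-x|=1}\lambda_{x,u}$,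 entries $-\lambda_{x,y}$ for $|x-y|=1$ and $0$ otherwise; assume that, almost surely, $h_{0,L}$ is positive definite for all $L\ge 1$. Let $h_L=\mu^{1/2}h_{0,L}\mu^{1/2}$ with $\mu=\mathrm{diag}(1/(2m_x))$. For $\alpha\in\mathbb R$ and $r>0$ say that $h_L$ has exponentially decaying $(\alpha,r)$-eigenfunction correlators if there are $C<\infty$ and $\eta>0$ with $$\mathbb E\Big(\sup_{|u|\le 1}\big|\langle\delta_x,h_L^{\alpha}u(h_L)\delta_y\rangle\big|^r\Big)\le Ce^{-\eta|x-y|}\qquad\text{for all }L\ge 1,\ x,y\in\Lambda_L,$$ the supremum being over all functions $u:\mathbb R\to\mathbb C$ with $|u|\le 1$ pointwise. Then, almost surely, for all $L\ge1$, $H_L$ has a normalized ground state $\Omega_L$, unique up to a phase. Write $\tau_t(A)=e^{itH_L}Ae^{-itH_L}$ and $\langle A\rangle=\langle\Omega_L,A\Omega_L\rangle$. The vector $\Omega_L$ lies in the domains of $\tau_t(q_x)q_y$, $\tau_t(q_x)p_y$, $\tau_t(p_x)q_y$, $\tau_t(p_x)p_y$ for all $t\in\mathbb R$ and $x,y\in\Lambda_L$,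 and the following hold, the suprema over $t$ being $\mathbb P$-a.e. equal to measurable functions. (a) If $h_L$ has exponentially decaying $(-1/2,r)$-eigenfunction correlators for some $r\in(0,1]$, then there exist $C'<\infty$ and $\mu'>0$ such that $$\mathbb E\Big(\sup_{t\in\mathbb R}|\langle\tau_t(q_x)q_y\rangle|^r\Big)\le C'e^{-\mu'|x-y|}\qquad\text{for all }L\ge 1,\ x,y\in\Lambda_L.$$ (b) If $h_L$ has exponentially decaying $(0,1)$-eigenfunction correlators, then there exist $C'<\infty$ and $\mu'>0$ such that $$\mathbb E\Big(\sup_{t\in\mathbb R}\max\{|\langle\tau_t(p_x)q_y\rangle|,|\langle\tau_t(q_x)p_y\rangle|,|\langle\tau_t(p_x)p_y\rangle|\}\Big)\le C'e^{-\mu'|x-y|}\qquad\text{for all }L\ge 1,\ x,y\in\Lambda_L.$$ -/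

import Mathlib

open MeasureTheory
open scoped ENNReal SchwartzMap LineDeriv

noncomputable section

namespace Oscillator

/-! ### Unbounded operators -/

section Unbounded

variable {E : Type*} [NormedAddCommGroup E] [InnerProductSpace ℂ E]

/-- The operator whose graph is the closure of `G`. -/
def closedOperator (G : Submodule ℂ (E × E)) : E →ₗ.[ℂ] E :=
  G.topologicalClosure.toLinearPMap

/-- The product `A B` of unbounded operators, with its natural domain
`{ψ ∈ D(B) : B ψ ∈ D(A)}`. -/
def opMul (A B : E →ₗ.[ℂ] E) : E →ₗ.[ℂ] E :=
  A.comp (B.domRestrict ((A.domain.comap B.toFun).map B.domain.subtype)) (by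
    rintro ⟨ψ, hψ, hB⟩
    obtain ⟨φ, hφ, rfl⟩ := hψ
    exact hφ)

/-- `ψ` solves the Schrödinger equation `i ψ' = H ψ` on the whole time axis. -/
def IsSchrodingerSolution (H : E →ₗ.[ℂ] E) (ψ : ℝ → E) : Prop :=
  ∀ t : ℝ, ∃ h : ψ t ∈ H.domain, HasDerivAt ψ (-Complex.I • H ⟨ψ t, h⟩) t

/-- The graph of the solution map `ψ(0) ↦ ψ(t)` of the Schrödinger equation. -/
def solutionGraph (H : E →ₗ.[ℂ] E) (t : ℝ) : Submodule ℂ (E × E) where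
  carrier := {v | ∃ ψ : ℝ → E, IsSchrodingerSolution H ψ ∧ v = (ψ 0, ψ t)}
  zero_mem' := by
    refine ⟨fun _ => 0, fun t => ⟨H.domain.zero_mem, ?_⟩, rfl⟩
    have h0 : H ⟨(0 : E), H.domain.zero_mem⟩ = 0 := H.map_zero
    rw [h0, smul_zero]
    exact hasDerivAt_const t 0
  add_mem' := by
    rintro _ _ ⟨ψ, hψ, rfl⟩ ⟨φ, hφ, rfl⟩
    refine ⟨fun t => ψ t + φ t, fun t => ?_, rfl⟩
    obtain ⟨h₁, d₁⟩ := hψ t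
    obtain ⟨h₂, d₂⟩ := hφ t
    refine ⟨H.domain.add_mem h₁ h₂, ?_⟩
    have hadd : H ⟨ψ t + φ t, H.domain.add_mem h₁ h₂⟩ = H ⟨ψ t, h₁⟩ + H ⟨φ t, h₂⟩ :=
      H.map_add ⟨ψ t, h₁⟩ ⟨φ t, h₂⟩
    rw [hadd, smul_add]
    exact d₁.add d₂
  smul_mem' := by
    rintro c _ ⟨ψ, hψ, rfl⟩
    refine ⟨fun t => c • ψ t, fun t => ?_, rfl⟩
    obtain ⟨h₁, d₁⟩ := hψ t
    refine ⟨H.domain.smul_mem c h₁, ?_⟩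
    have hsmul : H ⟨c • ψ t, H.domain.smul_mem c h₁⟩ = c • H ⟨ψ t, h₁⟩ :=
      H.map_smul c ⟨ψ t, h₁⟩
    rw [hsmul, smul_comm]
    exact d₁.const_smul c

/-- The propagator `e^{-itH}`: the closure of the solution map of the Schrödinger equation. For a
self-adjoint `H` the solution map has domain `D(H)`, is isometric and has the unitary operator
`e^{-itH}` as its closure (Stone's theorem). -/
def propagator (H : E →ₗ.[ℂ] E) (t : ℝ) : E →ₗ.[ℂ] E :=
  closedOperator (solutionGraph H t)

/-- The Heisenberg evolution `τ_t(A) = e^{itH} A e^{-itH}`, with its natural domain. -/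
def heisenberg (H : E →ₗ.[ℂ] E) (t : ℝ) (A : E →ₗ.[ℂ] E) : E →ₗ.[ℂ] E :=
  opMul (propagator H (-t)) (opMul A (propagator H t))

/-- `Ψ` is a normalized ground state of `H`: a unit eigenvector whose eigenvalue is the minimum
of the quadratic form of `H` on unit vectors. -/
def IsGroundState (H : E →ₗ.[ℂ] E) (Ψ : E) : Prop :=
  ‖Ψ‖ = 1 ∧ ∃ e : ℝ, (∃ h : Ψ ∈ H.domain, H ⟨Ψ, h⟩ = (e : ℂ) • Ψ) ∧
    ∀ φ : H.domain, e * ‖(φ : E)‖ ^ 2 ≤ (inner ℂ (φ : E) (H φ)).re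

/-- The normalized ground state of `H` (some vector if there is none). -/
def groundState (H : E →ₗ.[ℂ] E) : E := Classical.epsilon (IsGroundState H)

open Classical in
/-- The expectation `⟨Ψ, A Ψ⟩`, for `Ψ` in the domain of `A`. -/
def expectation (Ψ : E) (A : E →ₗ.[ℂ] E) : ℂ :=
  if h : Ψ ∈ A.domain then inner ℂ Ψ (A ⟨Ψ, h⟩) else 0

end Unbounded

/-! ### Operators on `L²(ℝ^ι)` -/

section Schroedinger

variable (ι : Type*) [Fintype ι]

/-- The Hilbert space `L²(ℝ^ι, dq)`. -/
abbrev Hilb : Type _ := Lp ℂ 2 (volume : Measure (ι → ℝ))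

variable {ι}

/-- The closure in `L²(ℝ^ι)` of an operator given on the Schwartz space. -/
def closureOfSchwartz (T : 𝓢(ι → ℝ, ℂ) →L[ℂ] 𝓢(ι → ℝ, ℂ)) : Hilb ι →ₗ.[ℂ] Hilb ι :=
  let emb : 𝓢(ι → ℝ, ℂ) →L[ℂ] Hilb ι := SchwartzMap.toLpCLM ℂ ℂ 2 volume
  closedOperator (LinearMap.range (emb.prod (emb ∘L T)).toLinearMap)

/-- Multiplication by the coordinate `q_x` on the Schwartz space. -/
def posS (x : ι) : 𝓢(ι → ℝ, ℂ) →L[ℂ] 𝓢(ι → ℝ, ℂ) :=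
  SchwartzMap.smulLeftCLM ℂ (fun q : ι → ℝ => ((q x : ℝ) : ℂ))

/-- `-i ∂/∂q_x` on the Schwartz space. -/
def momS [DecidableEq ι] (x : ι) : 𝓢(ι → ℝ, ℂ) →L[ℂ] 𝓢(ι → ℝ, ℂ) :=
  -Complex.I • LineDeriv.lineDerivOpCLM ℂ 𝓢(ι → ℝ, ℂ) (Pi.single x 1 : ι → ℝ)

/-- The position operator `q_x` on `L²(ℝ^ι)`. -/
def posOp (x : ι) : Hilb ι →ₗ.[ℂ] Hilb ι := closureOfSchwartz (posS x)

/-- The momentum operator `p_x = -i ∂/∂q_x` on `L²(ℝ^ι)`. -/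
def momOp [DecidableEq ι] (x : ι) : Hilb ι →ₗ.[ℂ] Hilb ι := closureOfSchwartz (momS x)

end Schroedinger

/-! ### Functional calculus of real symmetric matrices -/

/-- `f(A) = O diag(f(λ_k)) Oᵀ` for a real symmetric matrix `A = O diag(λ_k) Oᵀ` and an arbitrary
function `f : ℝ → ℂ`; the entry at `(x, y)` is `⟨δ_x, f(A) δ_y⟩`. -/
def matFun {n : Type*} [Fintype n] [DecidableEq n] {A : Matrix n n ℝ} (hA : A.IsHermitian)
    (f : ℝ → ℂ) : Matrix n n ℂ :=
  fun x y => ∑ k, (hA.eigenvectorBasis k x : ℂ) * f (hA.eigenvalues k) *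
    (hA.eigenvectorBasis k y : ℂ)

/-! ### The oscillator system -/

/-- The distance `|x - y|` of lattice points in the `1`-norm. -/
def dist1 {d : ℕ} (x y : Fin d → ℤ) : ℤ := ∑ i, |x i - y i|

/-- The cube `Λ_L = [-L, L]^d ∩ ℤ^d`. -/
def box (d L : ℕ) : Finset (Fin d → ℤ) := Finset.Icc (fun _ => -(L : ℤ)) (fun _ => (L : ℤ))

/-- Masses `m_x`, spring constants `k_x` and couplings `λ_{x,y}`, the latter indexed by unordered
pairs; only the values of `lam` at nearest neighbours are ever used. -/
structure Params (d : ℕ) where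
  m : (Fin d → ℤ) → ℝ
  k : (Fin d → ℤ) → ℝ
  lam : Sym2 (Fin d → ℤ) → ℝ

namespace Params

variable {d : ℕ} (P : Params d) (L : ℕ)

/-- The uniform bounds on the parameters. -/
def Bounded (mmin mmax kmax lammax : ℝ) : Prop :=
  (∀ x, mmin ≤ P.m x ∧ P.m x ≤ mmax) ∧ (∀ x, 0 ≤ P.k x ∧ P.k x ≤ kmax) ∧
    ∀ x y, dist1 x y = 1 → 0 ≤ P.lam s(x, y) ∧ P.lam s(x, y) ≤ lammax

/-- The matrix `h_{0,L}`. -/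
def h0 : Matrix (box d L) (box d L) ℝ := fun x y =>
  if x = y then P.k x / 2 + ∑ u : box d L, if dist1 u.1 x.1 = 1 then P.lam s(x.1, u.1) else 0
  else if dist1 x.1 y.1 = 1 then -P.lam s(x.1, y.1) else 0

/-- The diagonal matrix `μ^{1/2}`, with `μ_{x,x} = 1 / (2 m_x)`. -/
def sqrtMu : Matrix (box d L) (box d L) ℝ :=
  Matrix.diagonal fun x => Real.sqrt (1 / (2 * P.m x))

/-- The one-particle Hamiltonian `h_L = μ^{1/2} h_{0,L} μ^{1/2}`. -/
def h : Matrix (box d L) (box d L) ℝ := P.sqrtMu L * P.h0 L * P.sqrtMu L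

theorem dist1_comm (x y : Fin d → ℤ) : dist1 x y = dist1 y x := by
  simp only [dist1, abs_sub_comm]

theorem h0_isHermitian : (P.h0 L).IsHermitian := by
  refine Matrix.IsHermitian.ext fun x y => ?_
  by_cases hxy : x = y
  · subst hxy; simp
  · simp [h0, hxy, Ne.symm hxy, dist1_comm y.1 x.1, Sym2.eq_swap (a := y.1) (b := x.1)]

theorem h_isHermitian : (P.h L).IsHermitian := by
  have hs : (P.sqrtMu L).conjTranspose = P.sqrtMu L := by
    simp [sqrtMu]
  unfold h
  rw [Matrix.IsHermitian, Matrix.conjTranspose_mul, Matrix.conjTranspose_mul, hs,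
    (P.h0_isHermitian L).eq, Matrix.mul_assoc]

/-- The Hamiltonian
`∑_x (p_x² / (2 m_x) + (k_x / 2) q_x²) + ∑_{{x,y}, |x-y|=1} λ_{x,y} (q_x - q_y)²`
on the Schwartz space. The last sum is written as half of the sum over ordered pairs. -/
def hamiltonianS : 𝓢(box d L → ℝ, ℂ) →L[ℂ] 𝓢(box d L → ℝ, ℂ) :=
  ∑ x : box d L, (((1 / (2 * P.m x) : ℝ) : ℂ) • (momS x ∘L momS x) +
      ((P.k x / 2 : ℝ) : ℂ) • (posS x ∘L posS x)) +
    (1 / 2 : ℂ) • ∑ x : box d L, ∑ y : box d L,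
      if dist1 x.1 y.1 = 1 then
        ((P.lam s(x.1, y.1) : ℝ) : ℂ) • ((posS x - posS y) ∘L (posS x - posS y))
      else 0

/-- The Hamiltonian `H_L`, the closure of the above operator in `L²(ℝ^{Λ_L})`. -/
def hamiltonian : Hilb (box d L) →ₗ.[ℂ] Hilb (box d L) := closureOfSchwartz (P.hamiltonianS L)

/-- The ground state `Ω_L` of `H_L`. -/
def gs : Hilb (box d L) := groundState (P.hamiltonian L)

/-- The operator `τ_t(A) B`, with the Heisenberg dynamics `τ_t` of `H_L`. -/
def dynOp (t : ℝ) (A B : Hilb (box d L) →ₗ.[ℂ] Hilb (box d L)) :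
    Hilb (box d L) →ₗ.[ℂ] Hilb (box d L) :=
  opMul (heisenberg (P.hamiltonian L) t A) B

/-- The dynamic ground state correlation `⟨τ_t(A) B⟩ = ⟨Ω_L, τ_t(A) B Ω_L⟩`. -/
def corr (t : ℝ) (A B : Hilb (box d L) →ₗ.[ℂ] Hilb (box d L)) : ℂ :=
  expectation (P.gs L) (P.dynOp L t A B)

/-- The supremum of `|⟨δ_x, h_L^α u(h_L) δ_y⟩|^r` over all functions `u : ℝ → ℂ` with
`|u| ≤ 1`. -/
def efc (α r : ℝ) (x y : box d L) : ℝ≥0∞ :=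
  ⨆ u : {u : ℝ → ℂ // ∀ s, ‖u s‖ ≤ 1},
    ‖matFun (P.h_isHermitian L) (fun s => ((s ^ α : ℝ) : ℂ) * u.1 s) x y‖ₑ ^ r

end Params

/-- The random one-particle Hamiltonians `h_L` have exponentially decaying
`(α, r)`-eigenfunction correlators. -/
def ExpDecayEFC {Ω : Type*} [MeasurableSpace Ω] {d : ℕ} (ℙ : Measure Ω) (P : Ω → Params d)
    (α r : ℝ) : Prop :=
  ∃ C μ : ℝ, 0 < μ ∧ ∀ L : ℕ, 1 ≤ L → ∀ x y : box d L,
    ∫⁻ ω, (P ω).efc L α r x y ∂ℙ ≤ ENNReal.ofReal (C * Real.exp (-μ * dist1 x.1 y.1))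

end Oscillator

end

open Oscillator

/-! The system decouples into normal modes. Let `s = μ^{1/2}`, and let `v k` be an orthonormal
eigenbasis of `h_L` with eigenvalues `γ k ^ 2`. Then `Q_k = ∑ x, (v k x / s x) q_x` and `P_k = ∑ x,
s x * v k x * p_x` again satisfy the canonical commutation relations, and the Hamiltonian is `∑ k,
(P_k² + γ_k² Q_k²)`. With `b_k = γ_k Q_k + i P_k` it becomes `∑ k, b_k* b_k + ∑ k, γ_k`, where
`[b_j, b_k*] = 2 γ_k δ_{jk}`; a Gaussian is annihilated by every `b_k`.

Positions and momenta are linear in the ladder operators, so the correlations only involve states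
with zero, one or two quanta. These are Schwartz eigenvectors, on which the propagator acts by a
phase; symmetry of the Hamiltonian is enough, and self-adjointness is never needed
(`IsLadder.exists_mem_dyn_graph`). The correlations come out as explicit constants times entries of
`h^α e^{-2it√h}`, with `α = -1/2` for position-position, `0` for the mixed ones and `1/2` for
momentum-momentum (`Params.exists_mem_dynOp_graph`). The phase has modulus one for each `t`, so an
eigenfunction correlator bounds the supremum over `t`. For `α = 1/2`, the bound
`Bounded.eigenvalues_le` on the spectrum, uniform in `L`, lets `√h` be absorbed into the bounded
function `u`.

For uniqueness, the energy above `∑ k, γ_k` is a sum of squares, so a ground state is orthogonal to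
the range of every raising operator. Divided by the Gaussian it has zero weak gradient, hence is
constant (`eq_smul_gaussianS`). Measurability needs no measurable choice of eigenvectors: functions
of `h` are limits of polynomials in `h`. -/

noncomputable section

namespace Oscillator

/-! ### Graphs of unbounded operators -/

section Graphs

variable {E : Type*} [NormedAddCommGroup E] [InnerProductSpace ℂ E]

/-- A linear relation that preserves the norm is single-valued, and so is its closure. -/
theorem norm_eq_of_mem_closure {G : Submodule ℂ (E × E)} (hG : ∀ v ∈ G, ‖v.1‖ = ‖v.2‖)
    {v : E × E} (hv : v ∈ G.topologicalClosure) : ‖v.1‖ = ‖v.2‖ := by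
  have hcl : IsClosed {v : E × E | ‖v.1‖ = ‖v.2‖} :=
    isClosed_eq (by fun_prop) (by fun_prop)
  exact closure_minimal (fun v hv => hG v hv) hcl hv

/-- `toLinearPMap` is meaningful only for single-valued relations, so every closure below must first
be shown to be one. -/
theorem closedOperator_graph {G : Submodule ℂ (E × E)}
    (hG : ∀ v ∈ G.topologicalClosure, v.1 = 0 → v.2 = 0) :
    (closedOperator G).graph = G.topologicalClosure :=
  Submodule.toLinearPMap_graph_eq _ hG

/-- Arguing with pairs in graphs yields domain membership and value together, so products of several
unbounded operators can be evaluated by chaining. -/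
theorem mem_opMul_graph {A B : E →ₗ.[ℂ] E} {a b c : E} (hB : (a, b) ∈ B.graph)
    (hA : (b, c) ∈ A.graph) : (a, c) ∈ (opMul A B).graph := by
  rw [LinearPMap.mem_graph_iff] at hA hB
  obtain ⟨⟨y, hy⟩, hya, hy'⟩ := hB
  obtain ⟨⟨z, hz⟩, hz₁, hz₂⟩ := hA
  dsimp only at hya hy' hz₁ hz₂ hy ⊢
  subst hz₁ hya
  rw [LinearPMap.mem_graph_iff]
  refine ⟨⟨y, ⟨⟨⟨y, hy⟩, ?_, rfl⟩, hy⟩⟩, rfl, ?_⟩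
  · change B ⟨y, hy⟩ ∈ A.domain
    rw [hy']; exact hz
  · rw [← hz₂]
    change A ⟨B ⟨y, hy⟩, _⟩ = A ⟨z, hz⟩
    congr 1
    exact Subtype.ext hy'

theorem mem_domain_of_mem_graph {A : E →ₗ.[ℂ] E} {a b : E} (h : (a, b) ∈ A.graph) :
    a ∈ A.domain := LinearPMap.mem_domain_of_mem_graph h

theorem apply_of_mem_graph {A : E →ₗ.[ℂ] E} {a b : E} (h : (a, b) ∈ A.graph)
    (ha : a ∈ A.domain) : A ⟨a, ha⟩ = b := by
  rw [LinearPMap.mem_graph_iff] at h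
  obtain ⟨⟨y, hy⟩, rfl, rfl⟩ := h
  rfl

theorem expectation_of_mem_graph {A : E →ₗ.[ℂ] E} {a b : E} (h : (a, b) ∈ A.graph) :
    expectation a A = inner ℂ a b := by
  have ha := mem_domain_of_mem_graph h
  rw [expectation, dif_pos ha, apply_of_mem_graph h ha]

/-! ### Propagators of symmetric operators -/

/-- `H` is symmetric. -/
def IsSymmOp (H : E →ₗ.[ℂ] E) : Prop :=
  ∀ φ ψ : H.domain, inner ℂ (H φ) (ψ : E) = inner ℂ (φ : E) (H ψ)

/-- The two terms in the derivative of `⟨ψ, ψ⟩` cancel by symmetry of `H`. -/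
theorem IsSchrodingerSolution.norm_eq {H : E →ₗ.[ℂ] E} (hH : IsSymmOp H) {ψ : ℝ → E}
    (hψ : IsSchrodingerSolution H ψ) (s t : ℝ) : ‖ψ s‖ = ‖ψ t‖ := by
  have hd : ∀ t, HasDerivAt (fun t => inner ℂ (ψ t) (ψ t)) 0 t := by
    intro t
    obtain ⟨h, d⟩ := hψ t
    have := d.inner ℂ d
    convert! this using 1
    rw [inner_smul_left, inner_smul_right, hH ⟨ψ t, h⟩ ⟨ψ t, h⟩]
    simp
  have hc := is_const_of_deriv_eq_zero (fun t => (hd t).differentiableAt)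
    (fun t => (hd t).deriv) s t
  simp only [inner_self_eq_norm_sq_to_K] at hc
  have : ‖ψ s‖ ^ 2 = ‖ψ t‖ ^ 2 := by exact_mod_cast hc
  exact (pow_left_inj₀ (norm_nonneg _) (norm_nonneg _) two_ne_zero).1 this

/-- Conservation of the norm survives the closure, which is therefore single-valued. -/
theorem propagator_graph {H : E →ₗ.[ℂ] E} (hH : IsSymmOp H) (t : ℝ) :
    (propagator H t).graph = (solutionGraph H t).topologicalClosure := by
  refine closedOperator_graph fun v hv h0 => ?_
  have h := norm_eq_of_mem_closure (G := solutionGraph H t) ?_ hv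
  · rw [h0, norm_zero] at h
    exact norm_eq_zero.1 h.symm
  · rintro _ ⟨ψ, hψ, rfl⟩
    exact hψ.norm_eq hH 0 t

/-- The propagator multiplies an eigenvector with a phase. -/
theorem mem_propagator_graph {H : E →ₗ.[ℂ] E} (hH : IsSymmOp H) (t : ℝ) {v : E} {e : ℝ}
    (hv : (v, (e : ℂ) • v) ∈ H.graph) :
    (v, Complex.exp (-(Complex.I * e * t)) • v) ∈ (propagator H t).graph := by
  rw [propagator_graph hH]
  refine Submodule.le_topologicalClosure _
    ⟨fun t : ℝ => Complex.exp (-(Complex.I * e * t)) • v, fun t => ?_, by simp⟩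
  have hg := H.graph.smul_mem (Complex.exp (-(Complex.I * e * t))) hv
  have hm := mem_domain_of_mem_graph hg
  refine ⟨hm, ?_⟩
  rw [apply_of_mem_graph hg hm]
  have h1 : HasDerivAt (fun t : ℝ => Complex.exp (-(Complex.I * e * t)))
      (Complex.exp (-(Complex.I * e * t)) * (-(Complex.I * e))) t := by
    have h2 : HasDerivAt (fun t : ℝ => -(Complex.I * e * t)) (-(Complex.I * e)) t := by
      have h3 := ((Complex.ofRealCLM.hasDerivAt (x := t)).const_mul (Complex.I * (e : ℂ))).neg
      simp only [Complex.ofRealCLM_apply, Complex.ofReal_one, mul_one] at h3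
      exact h3
    exact h2.cexp
  convert! h1.smul_const v using 1
  simp only [smul_smul]
  congr 1
  ring

theorem mem_graph_sum {κ : Type*} (s : Finset κ) {A : E →ₗ.[ℂ] E} {a b : κ → E}
    (h : ∀ k ∈ s, (a k, b k) ∈ A.graph) : (∑ k ∈ s, a k, ∑ k ∈ s, b k) ∈ A.graph := by
  have := A.graph.sum_mem h
  rwa [show ∑ k ∈ s, (a k, b k) = (∑ k ∈ s, a k, ∑ k ∈ s, b k) from
    Prod.ext (by simp [Prod.fst_sum]) (by simp [Prod.snd_sum])] at this

end Graphs

/-! ### Closures of operators given on a core -/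

section Core

variable {E : Type*} [NormedAddCommGroup E] [InnerProductSpace ℂ E]
  {S : Type*} [AddCommGroup S] [Module ℂ S]

/-- The closure of an operator `T` on a vector space `S` that is mapped into `E`. -/
def coreClosure (emb : S →ₗ[ℂ] E) (T : Module.End ℂ S) : E →ₗ.[ℂ] E :=
  closedOperator (LinearMap.range (emb.prod (emb ∘ₗ T)))

/-- `T'` is a formal adjoint of `T` with respect to the inner product of `E`. -/
def FormalAdjoint (emb : S →ₗ[ℂ] E) (T T' : Module.End ℂ S) : Prop :=
  ∀ f g, inner ℂ (emb (T f)) (emb g) = inner ℂ (emb f) (emb (T' g))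

variable {emb : S →ₗ[ℂ] E} {T T' T₁ T₂ : Module.End ℂ S}

theorem FormalAdjoint.add {T₁' T₂' : Module.End ℂ S} (h₁ : FormalAdjoint emb T₁ T₁')
    (h₂ : FormalAdjoint emb T₂ T₂') : FormalAdjoint emb (T₁ + T₂) (T₁' + T₂') := by
  intro f g
  simp only [LinearMap.add_apply, map_add, inner_add_left, inner_add_right, h₁ f g, h₂ f g]

theorem FormalAdjoint.smul (c : ℂ) (h : FormalAdjoint emb T T') :
    FormalAdjoint emb (c • T) ((starRingEnd ℂ c) • T') := by
  intro f g
  simp only [LinearMap.smul_apply, map_smul, inner_smul_left, inner_smul_right, h f g]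

theorem FormalAdjoint.real_smul (c : ℝ) (h : FormalAdjoint emb T T') :
    FormalAdjoint emb ((c : ℂ) • T) ((c : ℂ) • T') := by
  simpa using h.smul (c : ℂ)

theorem FormalAdjoint.sum {κ : Type*} (s : Finset κ) {T T' : κ → Module.End ℂ S}
    (h : ∀ k, FormalAdjoint emb (T k) (T' k)) :
    FormalAdjoint emb (∑ k ∈ s, T k) (∑ k ∈ s, T' k) := by
  intro f g
  simp only [LinearMap.sum_apply, map_sum, sum_inner, inner_sum, h _ f g]

theorem FormalAdjoint.mul {T₁' T₂' : Module.End ℂ S} (h₁ : FormalAdjoint emb T₁ T₁')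
    (h₂ : FormalAdjoint emb T₂ T₂') : FormalAdjoint emb (T₁ * T₂) (T₂' * T₁') := by
  intro f g
  simp [h₁ _ g, h₂ f _]

/-- Pairs in the closure of the graph satisfy the adjoint relation. -/
theorem FormalAdjoint.inner_eq_of_mem_closure (h : FormalAdjoint emb T T) {v : E × E}
    (hv : v ∈ (LinearMap.range (emb.prod (emb ∘ₗ T))).topologicalClosure) (g : S) :
    inner ℂ v.2 (emb g) = inner ℂ v.1 (emb (T g)) := by
  have hcl : IsClosed {v : E × E | inner ℂ v.2 (emb g) = inner ℂ v.1 (emb (T g))} :=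
    isClosed_eq (by fun_prop) (by fun_prop)
  refine closure_minimal ?_ hcl hv
  rintro _ ⟨f, rfl⟩
  exact h f g

theorem FormalAdjoint.inner_eq_of_mem_closure₂ (h : FormalAdjoint emb T T) {v w : E × E}
    (hv : v ∈ (LinearMap.range (emb.prod (emb ∘ₗ T))).topologicalClosure)
    (hw : w ∈ (LinearMap.range (emb.prod (emb ∘ₗ T))).topologicalClosure) :
    inner ℂ v.2 w.1 = inner ℂ v.1 w.2 := by
  have hcl : IsClosed {w : E × E | inner ℂ v.2 w.1 = inner ℂ v.1 w.2} :=
    isClosed_eq (by fun_prop) (by fun_prop)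
  refine closure_minimal ?_ hcl hw
  rintro _ ⟨g, rfl⟩
  exact h.inner_eq_of_mem_closure hv g

/-- A densely defined symmetric operator is closable: if `(0, b)` is in the closure of its graph,
then `b` is orthogonal to the dense core. -/
theorem FormalAdjoint.coreClosure_graph (hd : DenseRange emb) (h : FormalAdjoint emb T T) :
    (coreClosure emb T).graph = (LinearMap.range (emb.prod (emb ∘ₗ T))).topologicalClosure := by
  refine closedOperator_graph fun v hv h0 => ?_
  refine hd.eq_of_inner_left (𝕜 := ℂ) fun g => ?_
  rw [h.inner_eq_of_mem_closure hv g, h0, inner_zero_left, inner_zero_left]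

theorem FormalAdjoint.mem_coreClosure_graph (hd : DenseRange emb) (h : FormalAdjoint emb T T)
    (f : S) : (emb f, emb (T f)) ∈ (coreClosure emb T).graph := by
  rw [h.coreClosure_graph hd]
  exact Submodule.le_topologicalClosure _ ⟨f, rfl⟩

theorem FormalAdjoint.isSymmOp (hd : DenseRange emb) (h : FormalAdjoint emb T T) :
    IsSymmOp (coreClosure emb T) := by
  intro φ ψ
  have h1 := (coreClosure emb T).mem_graph φ
  have h2 := (coreClosure emb T).mem_graph ψ
  rw [h.coreClosure_graph hd] at h1 h2
  exact h.inner_eq_of_mem_closure₂ h1 h2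

end Core

/-! ### Ladder operators -/

section Ladder

variable {E : Type*} [NormedAddCommGroup E] [InnerProductSpace ℂ E]
  {S : Type*} [AddCommGroup S] [Module ℂ S] {κ : Type*} [Fintype κ] [DecidableEq κ]

/-- Lowering and raising operators `b k`, `bd k` that diagonalize `H = ∑ k, bd k * b k + e`, and
a vector `Ω` annihilated by the former. -/
structure IsLadder (emb : S →ₗ[ℂ] E) (H : Module.End ℂ S) (γ : κ → ℝ)
    (b bd : κ → Module.End ℂ S) (e : ℝ) (Ω : S) : Prop where
  adj : ∀ k, FormalAdjoint emb (b k) (bd k)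
  comm : ∀ j k f, b j (bd k f) = bd k (b j f) + if j = k then ((2 * γ k : ℝ) : ℂ) • f else 0
  comm_bd : ∀ j k f, bd j (bd k f) = bd k (bd j f)
  ham : ∀ f, H f = ∑ k, bd k (b k f) + (e : ℂ) • f
  vac : ∀ k, b k Ω = 0

theorem FormalAdjoint.symm {emb : S →ₗ[ℂ] E} {T T' : Module.End ℂ S}
    (h : FormalAdjoint emb T T') : FormalAdjoint emb T' T := by
  intro f g
  rw [← inner_conj_symm, ← h g f, inner_conj_symm]

namespace IsLadder

variable {emb : S →ₗ[ℂ] E} {H : Module.End ℂ S} {γ : κ → ℝ} {b bd : κ → Module.End ℂ S} {e : ℝ}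
  {Ω : S}

theorem smul (h : IsLadder emb H γ b bd e Ω) (c : ℂ) : IsLadder emb H γ b bd e (c • Ω) :=
  { h with vac := fun k => by rw [map_smul, h.vac, smul_zero] }

theorem formalAdjoint_ham (h : IsLadder emb H γ b bd e Ω) : FormalAdjoint emb H H := by
  have hH : H = ∑ k, bd k * b k + (e : ℂ) • 1 := by
    ext f; simp [h.ham f]
  rw [hH]
  refine (FormalAdjoint.sum _ fun k => (h.adj k).symm.mul (h.adj k)).add
    (FormalAdjoint.real_smul e fun f g => rfl)

theorem ham_vac (h : IsLadder emb H γ b bd e Ω) : H Ω = (e : ℂ) • Ω := by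
  simp [h.ham, h.vac]

/-- Only the summand `j = k` fails to commute with `bd k`; its commutator produces one quantum of
energy `2 γ k`. -/
theorem ham_raise (h : IsLadder emb H γ b bd e Ω) (k : κ) (f : S) :
    H (bd k f) = bd k (H f) + ((2 * γ k : ℝ) : ℂ) • bd k f := by
  rw [h.ham, h.ham]
  have : ∀ j, bd j (b j (bd k f)) =
      bd k (bd j (b j f)) + if j = k then ((2 * γ k : ℝ) : ℂ) • bd j f else 0 := by
    intro j
    rw [h.comm, map_add, h.comm_bd j k]
    congr 1
    split_ifs <;> simp
  simp only [this, Finset.sum_add_distrib, Finset.sum_ite_eq', Finset.mem_univ, if_true, map_add,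
    map_sum, map_smul]
  abel

theorem ham_raise_of_eigen (h : IsLadder emb H γ b bd e Ω) (k : κ) {f : S} {E₀ : ℝ}
    (hf : H f = (E₀ : ℂ) • f) : H (bd k f) = ((E₀ + 2 * γ k : ℝ) : ℂ) • bd k f := by
  rw [h.ham_raise, hf, map_smul, ← add_smul, Complex.ofReal_add]

/-- Since `bd k` is adjoint to `b k`, the energy above `e` is a sum of squares. This gives both the
minimality of `e` and the uniqueness of the minimizer. -/
theorem inner_ham (h : IsLadder emb H γ b bd e Ω) (f : S) :
    inner ℂ (emb f) (emb (H f)) =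
      ((∑ k, ‖emb (b k f)‖ ^ 2 + e * ‖emb f‖ ^ 2 : ℝ) : ℂ) := by
  rw [h.ham]
  simp only [map_add, map_sum, map_smul, inner_add_right, inner_sum, inner_smul_right,
    ← h.adj _ f, inner_self_eq_norm_sq_to_K]
  push_cast
  rfl

theorem le_inner_of_mem_closure (h : IsLadder emb H γ b bd e Ω) {v : E × E}
    (hv : v ∈ (LinearMap.range (emb.prod (emb ∘ₗ H))).topologicalClosure) :
    e * ‖v.1‖ ^ 2 ≤ (inner ℂ v.1 v.2).re := by
  have hcl : IsClosed {v : E × E | e * ‖v.1‖ ^ 2 ≤ (inner ℂ v.1 v.2).re} :=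
    isClosed_le (by fun_prop) (Complex.continuous_re.comp (by fun_prop))
  refine closure_minimal ?_ hcl hv
  rintro _ ⟨f, rfl⟩
  have := h.inner_ham f
  simp only [Set.mem_ofPred_eq, LinearMap.prod_apply, Function.prod, LinearMap.comp_apply]
  rw [this, Complex.ofReal_re]
  have : 0 ≤ ∑ k, ‖emb (b k f)‖ ^ 2 := by positivity
  linarith

theorem isGroundState (h : IsLadder emb H γ b bd e Ω) (hd : DenseRange emb)
    (hΩ : ‖emb Ω‖ = 1) : IsGroundState (coreClosure emb H) (emb Ω) := by
  have hg := h.formalAdjoint_ham.mem_coreClosure_graph hd Ω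
  rw [h.ham_vac, map_smul] at hg
  refine ⟨hΩ, e, ⟨mem_domain_of_mem_graph hg, apply_of_mem_graph hg _⟩, fun φ => ?_⟩
  have hφ := (coreClosure emb H).mem_graph φ
  rw [h.formalAdjoint_ham.coreClosure_graph hd] at hφ
  exact h.le_inner_of_mem_closure hφ

/-- A ground state is orthogonal to the ranges of the raising operators. -/
theorem inner_raise_eq_zero (h : IsLadder emb H γ b bd e Ω) (hd : DenseRange emb)
    (hΩ : ‖emb Ω‖ = 1) {Ψ : E} (hΨ : IsGroundState (coreClosure emb H) Ψ)
    (k : κ) (g : S) : inner ℂ (emb (bd k g)) Ψ = 0 := by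
  obtain ⟨-, e₀, ⟨h₁, h₂⟩, h₃⟩ := hΨ
  have hg := h.formalAdjoint_ham.mem_coreClosure_graph hd Ω
  rw [h.ham_vac, map_smul] at hg
  have hΩd := mem_domain_of_mem_graph hg
  -- The vacuum is a trial vector for the variational inequality satisfied by `Ψ`.
  have he : e₀ ≤ e := by
    have := h₃ ⟨_, hΩd⟩
    rw [apply_of_mem_graph hg] at this
    simpa [hΩ, inner_smul_right, inner_self_eq_norm_sq_to_K] using this
  have hm := (coreClosure emb H).mem_graph ⟨Ψ, h₁⟩
  rw [h₂, h.formalAdjoint_ham.coreClosure_graph hd] at hm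
  obtain ⟨v, hv, hlim⟩ := mem_closure_iff_seq_limit.1 hm
  choose f hf using hv
  -- `b k` acts only on the core, so it is applied to the approximants `f n` of `Ψ` in graph norm
  -- and not to `Ψ` itself.
  have hv1 : ∀ n, (v n).1 = emb (f n) := fun n => by rw [← hf n]; rfl
  have hv2 : ∀ n, (v n).2 = emb (H (f n)) := fun n => by rw [← hf n]; rfl
  rw [Prod.tendsto_iff] at hlim
  simp only [hv1, hv2] at hlim
  obtain ⟨l₁, l₂⟩ := hlim
  have l₃ : Filter.Tendsto (fun n => (inner ℂ (emb (f n)) (emb (H (f n)))).re -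
      e * ‖emb (f n)‖ ^ 2) Filter.atTop (nhds (e₀ * ‖Ψ‖ ^ 2 - e * ‖Ψ‖ ^ 2)) := by
    have := ((Complex.continuous_re.tendsto _).comp (l₁.inner (𝕜 := ℂ) l₂)).sub
      ((l₁.norm.pow 2).const_mul e)
    have hre : (inner ℂ Ψ ((e₀ : ℂ) • Ψ)).re = e₀ * ‖Ψ‖ ^ 2 := by
      rw [inner_smul_right, Complex.re_ofReal_mul]
      congr 1
      exact inner_self_eq_norm_sq (𝕜 := ℂ) Ψ
    rwa [hre] at this
  simp only [h.inner_ham, Complex.ofReal_re, add_sub_cancel_right] at l₃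
  have l₄ : Filter.Tendsto (fun n => ‖emb (b k (f n))‖ ^ 2) Filter.atTop (nhds 0) := by
    have hle : ∀ n, ‖emb (b k (f n))‖ ^ 2 ≤ ∑ k, ‖emb (b k (f n))‖ ^ 2 := fun n =>
      Finset.single_le_sum (f := fun k => ‖emb (b k (f n))‖ ^ 2) (fun _ _ => by positivity)
        (Finset.mem_univ k)
    -- The limit of the sums of squares is nonnegative, and `he` makes it nonpositive.
    have hlim0 : e₀ * ‖Ψ‖ ^ 2 - e * ‖Ψ‖ ^ 2 = 0 := by
      refine le_antisymm ?_ (ge_of_tendsto' l₃ fun n => by positivity)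
      nlinarith [sq_nonneg ‖Ψ‖]
    rw [hlim0] at l₃
    exact squeeze_zero (fun n => by positivity) hle l₃
  have l₅ : Filter.Tendsto (fun n => emb (b k (f n))) Filter.atTop (nhds 0) := by
    rw [tendsto_zero_iff_norm_tendsto_zero]
    have := (Real.continuous_sqrt.tendsto 0).comp l₄
    simpa [Function.comp_def, Real.sqrt_sq] using this
  have l₆ := (tendsto_const_nhds (x := emb (bd k g)) (f := Filter.atTop)).inner (𝕜 := ℂ) l₁
  have l₇ := (tendsto_const_nhds (x := emb g) (f := Filter.atTop)).inner (𝕜 := ℂ) l₅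
  rw [inner_zero_right] at l₇
  refine tendsto_nhds_unique l₆ (l₇.congr fun n => ?_)
  rw [(h.adj k).symm g (f n)]

/-- Dynamic ground state correlations of operators that are linear in the ladder operators. -/
theorem exists_mem_dyn_graph (h : IsLadder emb H γ b bd e Ω) (hd : DenseRange emb)
    (hΩ : ‖emb Ω‖ = 1) {A B : Module.End ℂ S} (hA : FormalAdjoint emb A A)
    (hB : FormalAdjoint emb B B) {α α' β β' : κ → ℂ}
    (hAf : ∀ f, A f = ∑ j, (α j • b j f + α' j • bd j f))
    (hBf : ∀ f, B f = ∑ j, (β j • b j f + β' j • bd j f)) (t : ℝ) :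
    ∃ Φ, (emb Ω, Φ) ∈ (opMul (heisenberg (coreClosure emb H) t (coreClosure emb A))
        (coreClosure emb B)).graph ∧
      inner ℂ (emb Ω) Φ =
        ∑ k, ((2 * γ k : ℝ) : ℂ) * α k * β' k * Complex.exp (-(2 * Complex.I * γ k * t)) := by
  have hsym := h.formalAdjoint_ham.isSymmOp hd
  have eig : ∀ {f : S} {E₀ : ℝ} (s : ℝ), H f = (E₀ : ℂ) • f →
      (emb f, Complex.exp (-(Complex.I * E₀ * s)) • emb f) ∈
        (propagator (coreClosure emb H) s).graph := by
    intro f E₀ s hf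
    refine mem_propagator_graph hsym s ?_
    rw [← map_smul, ← hf]
    exact h.formalAdjoint_ham.mem_coreClosure_graph hd f
  have h0 := h.ham_vac
  have h1 := fun k => h.ham_raise_of_eigen k h0
  have h2 := fun j k => h.ham_raise_of_eigen j (h1 k)
  set c : κ → ℂ := fun k => β' k * Complex.exp (-(Complex.I * (e + 2 * γ k : ℝ) * t)) with hc
  have gB : (emb Ω, ∑ k, β' k • emb (bd k Ω)) ∈ (coreClosure emb B).graph := by
    have := hB.mem_coreClosure_graph hd Ω
    rwa [hBf, map_sum, Finset.sum_congr rfl fun k _ =>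
      show emb (β k • b k Ω + β' k • bd k Ω) = β' k • emb (bd k Ω) by
        rw [h.vac, smul_zero, zero_add, map_smul]] at this
  have gU : (∑ k, β' k • emb (bd k Ω), emb (∑ k, c k • bd k Ω)) ∈
      (propagator (coreClosure emb H) t).graph := by
    rw [map_sum]
    refine mem_graph_sum _ fun k _ => ?_
    have := (propagator (coreClosure emb H) t).graph.smul_mem (β' k) (eig t (h1 k))
    rwa [Prod.smul_mk, smul_smul, ← map_smul _ (_ * _)] at this
  -- `A` sends a one-quantum state to two-quanta states plus a multiple of the vacuum, the latter
  -- through `b j (bd k Ω) = 2 γ k δ_{jk} Ω`.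
  have gA : (emb (∑ k, c k • bd k Ω), ∑ k, (∑ j, (c k * α' j) • emb (bd j (bd k Ω)) +
      (c k * (α k * ((2 * γ k : ℝ) : ℂ))) • emb Ω)) ∈ (coreClosure emb A).graph := by
    have := hA.mem_coreClosure_graph hd (∑ k, c k • bd k Ω)
    convert this using 2
    rw [map_sum, map_sum]
    refine Finset.sum_congr rfl fun k _ => ?_
    rw [map_smul, map_smul, hAf]
    simp only [h.comm, h.vac, map_zero, zero_add, map_sum, map_add, map_smul, smul_add,
      Finset.smul_sum, Finset.sum_add_distrib, smul_smul, smul_ite, smul_zero,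
      Finset.sum_ite_eq', Finset.mem_univ, if_true]
    rw [add_comm, mul_assoc]
  have gU' : (∑ k, (∑ j, (c k * α' j) • emb (bd j (bd k Ω)) +
      (c k * (α k * ((2 * γ k : ℝ) : ℂ))) • emb Ω),
      ∑ k, (∑ j, (c k * α' j) •
        Complex.exp (-(Complex.I * (e + 2 * γ k + 2 * γ j : ℝ) * (-t : ℝ))) •
          emb (bd j (bd k Ω)) +
      (c k * (α k * ((2 * γ k : ℝ) : ℂ))) • Complex.exp (-(Complex.I * e * (-t : ℝ))) • emb Ω)) ∈
      (propagator (coreClosure emb H) (-t)).graph := by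
    refine mem_graph_sum _ fun k _ => ?_
    refine Submodule.add_mem _ (x := (_, _)) (y := (_, _))
      (mem_graph_sum _ fun j _ => ?_) ?_
    · exact Submodule.smul_mem _ _ (x := (_, _)) (eig (-t) (h2 j k))
    · exact Submodule.smul_mem _ _ (x := (_, _)) (eig (-t) h0)
  refine ⟨_, mem_opMul_graph gB (mem_opMul_graph (mem_opMul_graph gU gA) gU'), ?_⟩
  -- Two-quanta states are orthogonal to the vacuum, so only the vacuum component contributes.
  have hz : ∀ j k, inner ℂ (emb Ω) (emb (bd j (bd k Ω))) = 0 := fun j k => by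
    rw [← h.adj j, h.vac, map_zero, inner_zero_left]
  simp only [inner_sum, inner_add_right, inner_smul_right, hz, mul_zero, Finset.sum_const_zero,
    zero_add, inner_self_eq_norm_sq_to_K, hΩ]
  refine Finset.sum_congr rfl fun k _ => ?_
  -- The zero-point energy `e` cancels between the forward and the backward evolution.
  have : Complex.exp (-(2 * Complex.I * γ k * t)) =
      Complex.exp (-(Complex.I * (e + 2 * γ k : ℝ) * t)) *
        Complex.exp (-(Complex.I * e * (-t : ℝ))) := by
    rw [← Complex.exp_add]
    congr 1
    push_cast
    ring
  rw [this, hc]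
  push_cast
  ring

end IsLadder

end Ladder

/-! ### Canonical commutation relations and normal modes -/

section CCR

variable {E : Type*} [NormedAddCommGroup E] [InnerProductSpace ℂ E]
  {S : Type*} [AddCommGroup S] [Module ℂ S]
  {ι : Type*} {κ : Type*} [DecidableEq κ]

/-- Symmetric operators `q x`, `p x` that satisfy the canonical commutation relations. -/
structure IsCCR [DecidableEq ι] (emb : S →ₗ[ℂ] E) (q p : ι → Module.End ℂ S) : Prop where
  symm_q : ∀ x, FormalAdjoint emb (q x) (q x)
  symm_p : ∀ x, FormalAdjoint emb (p x) (p x)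
  comm_q : ∀ x y f, q x (q y f) = q y (q x f)
  comm_p : ∀ x y f, p x (p y f) = p y (p x f)
  comm : ∀ x y f, p x (q y f) = q y (p x f) + if x = y then (-Complex.I) • f else 0

variable {emb : S →ₗ[ℂ] E} {q p : ι → Module.End ℂ S}

/-- A real linear combination of operators. -/
def combine [Fintype ι] (a : ι → ℝ) (q : ι → Module.End ℂ S) : Module.End ℂ S :=
  ∑ x, (a x : ℂ) • q x

theorem combine_apply [Fintype ι] (a : ι → ℝ) (q : ι → Module.End ℂ S) (f : S) :
    combine a q f = ∑ x, (a x : ℂ) • q x f := by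
  simp [combine]

theorem combine_combine_apply [Fintype ι] (a c : ι → ℝ) (q p : ι → Module.End ℂ S) (f : S) :
    combine a q (combine c p f) = ∑ x, ∑ y, ((a x * c y : ℝ) : ℂ) • q x (p y f) := by
  simp only [combine_apply, map_sum, map_smul, Finset.smul_sum, smul_smul, Complex.ofReal_mul]
  rw [Finset.sum_comm]
  simp only [mul_comm]

theorem combine_comm [Fintype ι] (a c : ι → ℝ) {q p : ι → Module.End ℂ S}
    (hq : ∀ x y f, q x (p y f) = p y (q x f)) (f : S) :
    combine a q (combine c p f) = combine c p (combine a q f) := by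
  rw [combine_combine_apply, combine_combine_apply, Finset.sum_comm]
  simp only [hq, mul_comm]

/-- The commutator is bilinear, so dual coefficient families preserve the canonical relations; they
need not be orthonormal, which leaves room for the masses. -/
theorem IsCCR.combine [Fintype ι] [DecidableEq ι] (h : IsCCR emb q p) {a c : κ → ι → ℝ}
    (hac : ∀ j k, ∑ x, c j x * a k x = if j = k then 1 else 0) :
    IsCCR emb (fun k => combine (a k) q) (fun k => combine (c k) p) where
  symm_q k := FormalAdjoint.sum _ fun x => (h.symm_q x).real_smul _
  symm_p k := FormalAdjoint.sum _ fun x => (h.symm_p x).real_smul _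
  comm_q j k f := combine_comm _ _ h.comm_q f
  comm_p j k f := combine_comm _ _ h.comm_p f
  comm j k f := by
    rw [combine_combine_apply, combine_combine_apply]
    simp only [h.comm, smul_add, Finset.sum_add_distrib, smul_ite, smul_zero, Finset.sum_ite_eq,
      Finset.mem_univ, if_true]
    congr 1
    · rw [Finset.sum_comm]
      simp only [mul_comm]
    · rw [← Finset.sum_smul, ← Complex.ofReal_sum, hac]
      split_ifs <;> simp

/-- The ladder operators of a system of uncoupled oscillators. -/
theorem IsCCR.isLadder [Fintype κ] {Q P : κ → Module.End ℂ S} (h : IsCCR emb Q P) (γ : κ → ℝ)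
    {H : Module.End ℂ S}
    (hH : ∀ f, H f = ∑ k, (P k (P k f) + ((γ k ^ 2 : ℝ) : ℂ) • Q k (Q k f))) {Ω : S}
    (hΩ : ∀ k, (γ k : ℂ) • Q k Ω + Complex.I • P k Ω = 0) :
    IsLadder emb H γ (fun k => (γ k : ℂ) • Q k + Complex.I • P k)
      (fun k => (γ k : ℂ) • Q k + (-Complex.I) • P k) (∑ k, γ k) Ω where
  adj k := by
    simpa using ((h.symm_q k).real_smul (γ k)).add ((h.symm_p k).smul Complex.I)
  comm j k f := by
    simp only [LinearMap.add_apply, LinearMap.smul_apply, map_add, map_smul, smul_add, h.comm,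
      h.comm_q j k, h.comm_p j k]
    rcases eq_or_ne j k with rfl | hjk
    · simp only [if_true]
      match_scalars <;> ring_nf <;> simp only [Complex.I_sq] <;> ring
    · simp only [if_neg hjk, if_neg hjk.symm]
      module
  comm_bd j k f := by
    simp only [LinearMap.add_apply, LinearMap.smul_apply, map_add, map_smul, smul_add, h.comm,
      h.comm_q j k, h.comm_p j k]
    rcases eq_or_ne j k with rfl | hjk
    · rfl
    · simp only [if_neg hjk, if_neg hjk.symm]
      module
  ham f := by
    -- Mode by mode, `bd k * b k = P² + γ² Q² - γ`, the last term coming from `iγ[Q, P] = -γ`; hence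
    -- the constant `∑ k, γ k`.
    rw [hH, Complex.ofReal_sum, Finset.sum_smul, ← Finset.sum_add_distrib]
    refine Finset.sum_congr rfl fun k _ => ?_
    simp only [LinearMap.add_apply, LinearMap.smul_apply, map_add, map_smul, smul_add, h.comm,
      if_true]
    match_scalars <;> ring_nf <;> simp only [Complex.I_sq] <;> ring
  vac k := hΩ k

end CCR

/-! ### Position and momentum on the Schwartz space -/

section SchwartzOps

variable {ι : Type*} [Fintype ι]

/-- The embedding of the Schwartz space into `L²`. -/
def embS (ι : Type*) [Fintype ι] : 𝓢(ι → ℝ, ℂ) →ₗ[ℂ] Hilb ι :=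
  (SchwartzMap.toLpCLM ℂ ℂ 2 volume).toLinearMap

theorem embS_apply (f : 𝓢(ι → ℝ, ℂ)) : embS ι f = f.toLp 2 volume := rfl

theorem denseRange_embS : DenseRange (embS ι) :=
  SchwartzMap.denseRange_toLpCLM (E := ι → ℝ) (F := ℂ) (p := 2) (μ := volume)
    ENNReal.ofNat_ne_top

theorem inner_embS (f g : 𝓢(ι → ℝ, ℂ)) :
    inner ℂ (embS ι f) (embS ι g) = ∫ q, (starRingEnd ℂ) (f q) * g q := by
  refine (SchwartzMap.inner_toL2_toL2_eq f g volume).trans ?_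
  simp only [RCLike.inner_apply']

theorem hasTemperateGrowth_coord (x : ι) :
    (fun q : ι → ℝ => ((q x : ℝ) : ℂ)).HasTemperateGrowth :=
  (Complex.ofRealCLM ∘L
    ContinuousLinearMap.proj (R := ℝ) (φ := fun _ : ι => ℝ) x).hasTemperateGrowth

theorem posS_apply (x : ι) (f : 𝓢(ι → ℝ, ℂ)) (q : ι → ℝ) : posS x f q = (q x : ℂ) * f q := by
  rw [posS, SchwartzMap.smulLeftCLM_apply_apply (hasTemperateGrowth_coord x), smul_eq_mul]

theorem lineDerivOp_comm (v w : ι → ℝ) (f : 𝓢(ι → ℝ, ℂ)) :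
    ∂_{v} (∂_{w} f) = (∂_{w} (∂_{v} f) : 𝓢(ι → ℝ, ℂ)) := by
  have key : ∀ (v w x : ι → ℝ),
      (∂_{v} (∂_{w} f) : 𝓢(ι → ℝ, ℂ)) x = fderiv ℝ (fderiv ℝ f) x v w := by
    intro v w x
    rw [SchwartzMap.lineDerivOp_apply_eq_fderiv]
    have h1 : ((∂_{w} f : 𝓢(ι → ℝ, ℂ)) : (ι → ℝ) → ℂ) = fun y => fderiv ℝ f y w := by
      ext y; rw [SchwartzMap.lineDerivOp_apply_eq_fderiv]
    have h2 : DifferentiableAt ℝ (fderiv ℝ f) x :=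
      ((f.smooth 2).fderiv_right (m := 1) (by norm_num)).differentiable (by norm_num) x
    rw [h1, fderiv_clm_apply h2 (differentiableAt_const w)]
    simp
  ext x
  rw [key, key]
  have hs := (f.smooth 2).contDiffAt (x := x)
  exact (hs.isSymmSndFDerivAt (by simp)) v w

theorem formalAdjoint_posS (x : ι) :
    FormalAdjoint (embS ι) (posS x).toLinearMap (posS x).toLinearMap := by
  intro f g
  simp only [ContinuousLinearMap.coe_coe, inner_embS, posS_apply, map_mul, Complex.conj_ofReal]
  congr 1; ext q; ring


theorem momS_apply [DecidableEq ι] (x : ι) (f : 𝓢(ι → ℝ, ℂ)) :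
    momS x f = (-Complex.I) • (∂_{(Pi.single x 1 : ι → ℝ)} f : 𝓢(ι → ℝ, ℂ)) := rfl

theorem lineDerivOp_posS (v : ι → ℝ) (x : ι) (f : 𝓢(ι → ℝ, ℂ)) :
    (∂_{v} (posS x f) : 𝓢(ι → ℝ, ℂ)) = posS x (∂_{v} f) + ((v x : ℝ) : ℂ) • f := by
  ext q
  have h1 : (posS x f : (ι → ℝ) → ℂ) = fun q => (q x : ℂ) * f q := by
    ext q; rw [posS_apply]
  have h2 : HasFDerivAt (fun q : ι → ℝ => (q x : ℂ))
      (Complex.ofRealCLM ∘L ContinuousLinearMap.proj (R := ℝ) (φ := fun _ : ι => ℝ) x) q :=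
    (Complex.ofRealCLM ∘L
      ContinuousLinearMap.proj (R := ℝ) (φ := fun _ : ι => ℝ) x).hasFDerivAt
  have h3 : HasFDerivAt (fun q => (q x : ℂ) * f q) _ q := h2.mul (f.hasFDerivAt q)
  rw [SchwartzMap.lineDerivOp_apply_eq_fderiv, h1, h3.fderiv, add_apply, add_apply,
    smul_apply, smul_apply, smul_apply, posS_apply, SchwartzMap.lineDerivOp_apply_eq_fderiv]
  simp [mul_comm]

/-- Integration by parts for the pairing `conj f * g`; its minus sign is compensated by conjugating
`-i`. -/
theorem formalAdjoint_momS [DecidableEq ι] (x : ι) :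
    FormalAdjoint (embS ι) (momS x).toLinearMap (momS x).toLinearMap := by
  intro f g
  simp only [ContinuousLinearMap.coe_coe, momS_apply, map_smul, inner_smul_left,
    inner_smul_right, inner_embS]
  have := SchwartzMap.integral_bilinear_lineDerivOp_right_eq_neg_left (μ := volume) f g
    ((ContinuousLinearMap.mul ℝ ℂ).comp (Complex.conjCLE : ℂ →L[ℝ] ℂ)) (Pi.single x 1)
  simp only [ContinuousLinearMap.comp_apply, ContinuousLinearMap.mul_apply',
    ContinuousLinearEquiv.coe_coe, Complex.conjCLE_apply] at this
  rw [this]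
  simp

theorem isCCR_schwartz [DecidableEq ι] : IsCCR (embS ι) (fun x => (posS x).toLinearMap)
    (fun x => (momS x).toLinearMap) where
  symm_q := formalAdjoint_posS
  symm_p := formalAdjoint_momS
  comm_q x y f := by
    ext q
    simp only [ContinuousLinearMap.coe_coe, posS_apply]
    ring
  comm_p x y f := by
    simp only [ContinuousLinearMap.coe_coe, momS_apply, LineDeriv.lineDerivOp_smul]
    rw [lineDerivOp_comm]
  comm x y f := by
    simp only [ContinuousLinearMap.coe_coe, momS_apply, lineDerivOp_posS, smul_add, map_smul]
    congr 1
    rcases eq_or_ne x y with rfl | h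
    · simp
    · simp [h, h.symm]

end SchwartzOps

/-! ### Gaussians as Schwartz functions -/

section Gaussian

variable {V : Type*} [NormedAddCommGroup V] [NormedSpace ℝ V]

/-- Differentiating `f' = f g` by the Leibniz rule costs only polynomial factors, because `g` has
temperate growth. The bound is uniform over orders `i ≤ n` since the Leibniz sum involves all lower
ones. -/
theorem norm_iteratedFDeriv_le_of_fderiv_eq_smul {f : V → ℂ} {g : V → V →L[ℝ] ℂ}
    (hf : ContDiff ℝ (⊤ : ℕ∞) f) (hg : g.HasTemperateGrowth) (hfg : ∀ x, fderiv ℝ f x = f x • g x)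
    (n : ℕ) : ∃ (C : ℝ) (k : ℕ), 0 ≤ C ∧ ∀ i ≤ n, ∀ x,
      ‖iteratedFDeriv ℝ i f x‖ ≤ C * (1 + ‖x‖) ^ k * ‖f x‖ := by
  induction n with
  | zero =>
    refine ⟨1, 0, zero_le_one, fun i hi x => ?_⟩
    obtain rfl : i = 0 := by omega
    simp
  | succ n ih =>
    obtain ⟨C, k, hC, h⟩ := ih
    obtain ⟨l, D, hD, hgD⟩ := hg.norm_iteratedFDeriv_le_uniform n
    refine ⟨C + ∑ i ∈ Finset.range (n + 1), (n.choose i : ℝ) * C * D, k + l, by positivity,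
      fun i hi x => ?_⟩
    have h1 : (1 : ℝ) ≤ 1 + ‖x‖ := by linarith [norm_nonneg x]
    have hS : 0 ≤ ∑ i ∈ Finset.range (n + 1), (n.choose i : ℝ) * C * D := by positivity
    rcases Nat.lt_or_ge i (n + 1) with hi' | hi'
    · refine (h i (by omega) x).trans ?_
      gcongr
      · linarith
      · omega
    · obtain rfl : i = n + 1 := by omega
      rw [← norm_iteratedFDeriv_fderiv]
      have hfun : fderiv ℝ f = fun x => f x • g x := funext hfg
      rw [hfun]
      refine (norm_iteratedFDeriv_smul_le hf hg.1 x
        (n := n) (by exact_mod_cast le_top)).trans ?_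
      rw [add_mul, add_mul, Finset.sum_mul, Finset.sum_mul]
      have hle : ∀ i ∈ Finset.range (n + 1), (n.choose i : ℝ) * ‖iteratedFDeriv ℝ i f x‖ *
          ‖iteratedFDeriv ℝ (n - i) g x‖ ≤
          (n.choose i : ℝ) * C * D * (1 + ‖x‖) ^ (k + l) * ‖f x‖ := by
        intro i hi
        have hi : i ≤ n := by simpa [Nat.lt_succ_iff] using hi
        calc (n.choose i : ℝ) * ‖iteratedFDeriv ℝ i f x‖ * ‖iteratedFDeriv ℝ (n - i) g x‖
            ≤ (n.choose i : ℝ) * (C * (1 + ‖x‖) ^ k * ‖f x‖) * (D * (1 + ‖x‖) ^ l) := by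
              gcongr
              · exact h i hi x
              · exact hgD _ (by omega) x
          _ = _ := by rw [pow_add]; ring
      refine (Finset.sum_le_sum hle).trans ?_
      have : 0 ≤ C * (1 + ‖x‖) ^ (k + l) * ‖f x‖ := by positivity
      linarith

/-- Combine `1 + r ≤ 2 (1 + r²)` with `T ^ N / N! ≤ exp T` at `T = c (1 + r²)`; the shift by `1`
accounts for the factor `exp c`. -/
theorem exists_one_add_pow_mul_exp_le {c : ℝ} (hc : 0 < c) (N : ℕ) :
    ∃ C : ℝ, ∀ r : ℝ, 0 ≤ r → (1 + r) ^ N * Real.exp (-(c * r ^ 2)) ≤ C := by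
  refine ⟨2 ^ N * (N.factorial / c ^ N * Real.exp c), fun r hr => ?_⟩
  have h1 : (1 + r) ^ N ≤ 2 ^ N * (1 + r ^ 2) ^ N := by
    rw [← mul_pow]
    exact pow_le_pow_left₀ (by positivity) (by nlinarith [sq_nonneg (r - 1)]) N
  have h2 := Real.pow_div_factorial_le_exp (c * (1 + r ^ 2)) (by positivity) N
  have h3 : (1 + r ^ 2) ^ N ≤ N.factorial / c ^ N * Real.exp (c * (1 + r ^ 2)) := by
    rw [mul_pow, div_le_iff₀ (by positivity)] at h2
    rw [div_mul_eq_mul_div, le_div_iff₀ (by positivity)]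
    linarith
  have h4 : Real.exp c = Real.exp (c * (1 + r ^ 2)) * Real.exp (-(c * r ^ 2)) := by
    rw [← Real.exp_add]; congr 1; ring
  calc (1 + r) ^ N * Real.exp (-(c * r ^ 2))
      ≤ 2 ^ N * (N.factorial / c ^ N * Real.exp (c * (1 + r ^ 2))) * Real.exp (-(c * r ^ 2)) := by
        gcongr
        exact h1.trans (by gcongr)
    _ = _ := by rw [h4]; ring

variable {κ : Type*} [Fintype κ] {ℓ : κ → V →L[ℝ] ℝ} {γ : κ → ℝ}

/-- The Gaussian `exp (-½ ∑ k, γ k (ℓ k x)²)`. -/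
def gaussian (ℓ : κ → V →L[ℝ] ℝ) (γ : κ → ℝ) (x : V) : ℝ :=
  Real.exp (-(1 / 2) * ∑ k, γ k * ℓ k x ^ 2)

theorem gaussian_pos (x : V) : 0 < gaussian ℓ γ x := Real.exp_pos _

theorem contDiff_gaussian {n : WithTop ℕ∞} : ContDiff ℝ n (gaussian ℓ γ) := by
  unfold gaussian
  fun_prop

theorem hasFDerivAt_gaussian (x : V) :
    HasFDerivAt (gaussian ℓ γ) (gaussian ℓ γ x • -∑ k, (γ k * ℓ k x) • ℓ k) x := by
  have h : HasFDerivAt (fun x => -(1 / 2) * ∑ k, γ k * ℓ k x ^ 2)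
      (-∑ k, (γ k * ℓ k x) • ℓ k) x := by
    have h1 : ∀ k ∈ Finset.univ, HasFDerivAt (fun x => γ k * ℓ k x ^ 2)
        (γ k • ((2 * ℓ k x) • ℓ k)) x := by
      intro k _
      have := ((ℓ k).hasFDerivAt (x := x)).pow 2
      simpa using this.const_mul (γ k)
    have h2 := (HasFDerivAt.fun_sum h1).const_mul (-(1 / 2))
    convert! h2 using 1
    ext y
    simp only [neg_apply, sum_apply, smul_apply, smul_eq_mul, Finset.mul_sum, ← Finset.sum_neg_distrib]
    exact Finset.sum_congr rfl fun k _ => by ring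
  exact h.exp

/-- The Gaussian as a complex valued Schwartz function. -/
def gaussianS (ℓ : κ → V →L[ℝ] ℝ) (γ : κ → ℝ)
    (h : ∃ c > 0, ∀ x, c * ‖x‖ ^ 2 ≤ 1 / 2 * ∑ k, γ k * ℓ k x ^ 2) : 𝓢(V, ℂ) where
  toFun x := (gaussian ℓ γ x : ℂ)
  smooth' := Complex.ofRealCLM.contDiff.comp contDiff_gaussian
  decay' := by
    intro k n
    obtain ⟨c, hc, h⟩ := h
    have hfg : ∀ x, fderiv ℝ (fun x => (gaussian ℓ γ x : ℂ)) x =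
        (gaussian ℓ γ x : ℂ) •
          (-∑ k, (γ k * ℓ k x) • (Complex.ofRealCLM ∘L ℓ k) : V →L[ℝ] ℂ) := by
      intro x
      have := (Complex.ofRealCLM.hasFDerivAt).comp x (hasFDerivAt_gaussian (ℓ := ℓ) (γ := γ) x)
      refine this.fderiv.trans ?_
      ext y
      simp
    have hg : (fun x => -∑ k, (γ k * ℓ k x) • (Complex.ofRealCLM ∘L ℓ k) :
        V → V →L[ℝ] ℂ).HasTemperateGrowth := by
      refine Function.HasTemperateGrowth.neg (Function.HasTemperateGrowth.sum fun k _ => ?_)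
      exact ((Function.HasTemperateGrowth.const _).mul (ℓ k).hasTemperateGrowth).smul
        (Function.HasTemperateGrowth.const _)
    obtain ⟨C, l, hC, hb⟩ := norm_iteratedFDeriv_le_of_fderiv_eq_smul
      (Complex.ofRealCLM.contDiff.comp contDiff_gaussian) hg hfg n
    obtain ⟨D, hD⟩ := exists_one_add_pow_mul_exp_le hc (k + l)
    refine ⟨C * D, fun x => ?_⟩
    have hnorm : ‖(gaussian ℓ γ x : ℂ)‖ ≤ Real.exp (-(c * ‖x‖ ^ 2)) := by
      rw [Complex.norm_real, Real.norm_of_nonneg (gaussian_pos x).le, gaussian]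
      exact Real.exp_le_exp.2 (by linarith [h x])
    calc _ ≤ (1 + ‖x‖) ^ k * (C * (1 + ‖x‖) ^ l * Real.exp (-(c * ‖x‖ ^ 2))) := by
          gcongr
          · linarith
          · refine (hb n le_rfl x).trans ?_
            gcongr
            exact hnorm
      _ = C * ((1 + ‖x‖) ^ (k + l) * Real.exp (-(c * ‖x‖ ^ 2))) := by rw [pow_add]; ring
      _ ≤ C * D := by
          gcongr
          exact hD _ (norm_nonneg x)

theorem gaussianS_apply (h) (x : V) : gaussianS ℓ γ h x = (gaussian ℓ γ x : ℂ) := rfl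

theorem lineDerivOp_gaussianS (h) (v x : V) :
    (∂_{v} (gaussianS ℓ γ h) : 𝓢(V, ℂ)) x =
      -((∑ k, γ k * ℓ k x * ℓ k v : ℝ) : ℂ) * gaussianS ℓ γ h x := by
  rw [SchwartzMap.lineDerivOp_apply_eq_fderiv]
  have := (Complex.ofRealCLM.hasFDerivAt).comp x (hasFDerivAt_gaussian (ℓ := ℓ) (γ := γ) x)
  have h2 : fderiv ℝ (gaussianS ℓ γ h) x = _ := this.fderiv
  rw [h2, gaussianS_apply]
  simp [mul_comm]

end Gaussian

/-! ### Functions with vanishing weak gradient -/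

section WeakGradient

open scoped Convolution ContDiff

variable {V : Type*} [NormedAddCommGroup V] [NormedSpace ℝ V] [FiniteDimensional ℝ V]
  [MeasurableSpace V] [BorelSpace V] {μ : Measure V} [μ.IsAddHaarMeasure]
  {κ : Type*} {w : κ → V} {F : V → ℂ}

/-- The derivative of `φ ⋆ F` at `x` along `w k` is, up to sign, the weak derivative of `F` tested
against `t ↦ φ (x - t)`. It vanishes on a spanning set of directions. -/
theorem convolution_const_of_weak_gradient_eq_zero (hw : Submodule.span ℝ (Set.range w) = ⊤)
    (hF : LocallyIntegrable F μ)
    (h : ∀ χ : V → ℝ, ContDiff ℝ ∞ χ → HasCompactSupport χ → ∀ k,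
      ∫ q, fderiv ℝ χ q (w k) • F q ∂μ = 0)
    {φ : V → ℝ} (hφ : ContDiff ℝ ∞ φ) (hφc : HasCompactSupport φ) (x y : V) :
    (φ ⋆[ContinuousLinearMap.lsmul ℝ ℝ, μ] F) x = (φ ⋆[ContinuousLinearMap.lsmul ℝ ℝ, μ] F) y := by
  have hφ1 : ContDiff ℝ 1 φ := hφ.of_le (by exact_mod_cast le_top)
  rw [← convolution_flip]
  set L := (ContinuousLinearMap.lsmul ℝ ℝ : ℝ →L[ℝ] ℂ →L[ℝ] ℂ).flip
  have hd : ∀ x, HasFDerivAt (F ⋆[L, μ] φ) ((F ⋆[L.precompR V, μ] fderiv ℝ φ) x) x :=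
    hφc.hasFDerivAt_convolution_right L hF hφ1
  refine is_const_of_fderiv_eq_zero (𝕜 := ℝ) (fun x => (hd x).differentiableAt) (fun x => ?_) x y
  rw [(hd x).fderiv]
  refine ContinuousLinearMap.coe_injective (LinearMap.ext_on_range (v := w) hw fun k => ?_)
  rw [ContinuousLinearMap.coe_coe, convolution_precompR_apply L hF (hφc.fderiv ℝ)
    (hφ1.continuous_fderiv (by norm_num)), convolution_def]
  have hχ : ContDiff ℝ ∞ fun t => φ (x - t) := hφ.comp (contDiff_const.sub contDiff_id)
  have hχc : HasCompactSupport fun t => φ (x - t) :=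
    hφc.comp_homeomorph (Homeomorph.subLeft x)
  have := h _ hχ hχc k
  have hder : ∀ t, fderiv ℝ (fun t => φ (x - t)) t (w k) = -fderiv ℝ φ (x - t) (w k) := by
    intro t
    have h1 : HasFDerivAt (fun t => x - t) (-ContinuousLinearMap.id ℝ V) t := by
      simpa using (hasFDerivAt_id t).const_sub x
    have h2 := ((hφ1.differentiable (by norm_num) (x - t)).hasFDerivAt).comp t h1
    have h3 : fderiv ℝ (fun t => φ (x - t)) t = _ := h2.fderiv
    rw [h3]
    simp
  simp only [hder, neg_smul, integral_neg, neg_eq_zero] at this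
  simpa [L] using this

/-- Almost everywhere `F` is the limit of its mollifications, each of which is constant; the limits
at two such points therefore agree. -/
theorem ae_const_of_weak_gradient_eq_zero (hw : Submodule.span ℝ (Set.range w) = ⊤)
    (hF : LocallyIntegrable F μ)
    (h : ∀ χ : V → ℝ, ContDiff ℝ ∞ χ → HasCompactSupport χ → ∀ k,
      ∫ q, fderiv ℝ χ q (w k) • F q ∂μ = 0) :
    ∃ c : ℂ, ∀ᵐ q ∂μ, F q = c := by
  let φ : ℕ → ContDiffBump (0 : V) := fun n =>
    { rIn := 1 / (n + 1 : ℝ)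
      rOut := 2 * (1 / (n + 1 : ℝ))
      rIn_pos := by positivity
      rIn_lt_rOut := by
        have : (0 : ℝ) < 1 / (n + 1 : ℝ) := by positivity
        linarith }
  have hlim : Filter.Tendsto (fun n => (φ n).rOut) Filter.atTop (nhds 0) := by
    simpa [φ] using (tendsto_one_div_add_atTop_nhds_zero_nat (𝕜 := ℝ)).const_mul 2
  have hae := ContDiffBump.ae_convolution_tendsto_right_of_locallyIntegrable (μ := μ) (K := 2)
    hlim (Filter.Eventually.of_forall fun n => le_rfl) hF
  obtain ⟨q₀, hq₀⟩ := hae.exists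
  refine ⟨F q₀, hae.mono fun q hq => tendsto_nhds_unique hq (hq₀.congr fun n => ?_)⟩
  exact convolution_const_of_weak_gradient_eq_zero hw hF h ((φ n).contDiff_normed)
    (φ n).hasCompactSupport_normed _ _

end WeakGradient

/-! ### Uniqueness of the Gaussian ground state -/

section Unique

open scoped ContDiff

variable {ι : Type*} [Fintype ι] {κ : Type*} [Fintype κ] [DecidableEq κ]

/-- An `L²` function orthogonal to the ranges of all raising operators is a multiple of the
Gaussian. -/
theorem eq_smul_gaussianS {ℓ : κ → (ι → ℝ) →L[ℝ] ℝ} {γ : κ → ℝ} (hG) {w : κ → ι → ℝ}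
    (hw : Submodule.span ℝ (Set.range w) = ⊤)
    (hℓ : ∀ j k, ℓ j (w k) = if j = k then 1 else 0)
    {bd : κ → Module.End ℂ 𝓢(ι → ℝ, ℂ)}
    (hbd : ∀ k g q, bd k g q =
      ((γ k * ℓ k q : ℝ) : ℂ) * g q - (∂_{w k} g : 𝓢(ι → ℝ, ℂ)) q)
    {Ψ : Hilb ι} (hΨ : ∀ k g, inner ℂ (embS ι (bd k g)) Ψ = 0) :
    ∃ c : ℂ, Ψ = c • embS ι (gaussianS ℓ γ hG) := by
  have hne : ∀ q, gaussian ℓ γ q ≠ 0 := fun q => (gaussian_pos q).ne'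
  have hcont : Continuous (gaussian ℓ γ) := (contDiff_gaussian (n := 0)).continuous
  -- The inverse Gaussian is continuous but unbounded in general, so only local integrability is
  -- claimed, which is all the weak gradient argument requires.
  have hF : LocallyIntegrable (fun q => (gaussian ℓ γ q)⁻¹ • Ψ q) volume := by
    have h1 : LocallyIntegrable Ψ volume :=
      (Lp.memLp Ψ).locallyIntegrable (by norm_num)
    rw [locallyIntegrable_iff] at h1 ⊢
    intro K hK
    exact (h1 K hK).continuousOn_smul (hcont.inv₀ hne).continuousOn hK
  obtain ⟨c, hc⟩ := ae_const_of_weak_gradient_eq_zero hw hF (by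
    intro χ hχ hχc k
    have hgs : ContDiff ℝ ∞ fun q => ((χ q * (gaussian ℓ γ q)⁻¹ : ℝ) : ℂ) :=
      Complex.ofRealCLM.contDiff.comp (hχ.mul (contDiff_gaussian.inv hne))
    have hgc : HasCompactSupport fun q => ((χ q * (gaussian ℓ γ q)⁻¹ : ℝ) : ℂ) :=
      (hχc.mul_right (f' := fun q => (gaussian ℓ γ q)⁻¹)).comp_left Complex.ofReal_zero
    set g : 𝓢(ι → ℝ, ℂ) := hgc.toSchwartzMap hgs with hg
    -- Differentiating the inverse Gaussian produces `γ k * ℓ k q`, which cancels the multiplication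
    -- part of `bd k`. Orthogonality to `bd k g` thus becomes the weak equation tested with `χ`.
    have hbg : ∀ q, bd k g q = -((fderiv ℝ χ q (w k) * (gaussian ℓ γ q)⁻¹ : ℝ) : ℂ) := by
      intro q
      rw [hbd, SchwartzMap.lineDerivOp_apply_eq_fderiv]
      have h1 := hasFDerivAt_gaussian (ℓ := ℓ) (γ := γ) q
      have h2 := ((hχ.differentiable (by norm_num) q).hasFDerivAt).mul
        ((hasDerivAt_inv (hne q)).comp_hasFDerivAt q h1)
      have h3 := (Complex.ofRealCLM.hasFDerivAt).comp q h2
      have h4 : fderiv ℝ g q = _ := h3.fderiv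
      have h5 : g q = ((χ q * (gaussian ℓ γ q)⁻¹ : ℝ) : ℂ) := rfl
      have h6 : ∑ j, γ j * ℓ j q * ℓ j (w k) = γ k * ℓ k q := by simp [hℓ]
      rw [h4, h5]
      simp only [ContinuousLinearMap.comp_apply, add_apply, smul_apply, neg_apply, sum_apply,
        smul_eq_mul, h6, Complex.ofRealCLM_apply, Function.comp_apply]
      rw [← Complex.ofReal_mul, ← Complex.ofReal_sub, ← Complex.ofReal_neg]
      congr 1
      have := hne q
      field_simp
      ring
    have h0 := hΨ k g
    rw [L2.inner_def] at h0
    have h1 : ∫ q, inner ℂ ((embS ι (bd k g) : Hilb ι) q) (Ψ q) =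
        -∫ q, fderiv ℝ χ q (w k) • (gaussian ℓ γ q)⁻¹ • Ψ q := by
      rw [← integral_neg]
      refine integral_congr_ae ?_
      filter_upwards [(bd k g).coeFn_toLp 2 volume] with q hq
      rw [embS_apply, hq, hbg, RCLike.inner_apply', smul_smul, ← Complex.ofReal_neg,
        Complex.real_smul, Complex.conj_ofReal]
      simp
    rw [h1, neg_eq_zero] at h0
    exact h0)
  refine ⟨c, Lp.ext ?_⟩
  filter_upwards [hc, Lp.coeFn_smul c (embS ι (gaussianS ℓ γ hG)),
    (gaussianS ℓ γ hG).coeFn_toLp 2 volume] with q h1 h2 h3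
  rw [h2, Pi.smul_apply, embS_apply, h3, gaussianS_apply, ← h1, smul_eq_mul, Complex.real_smul]
  have : (gaussian ℓ γ q : ℂ) ≠ 0 := by exact_mod_cast hne q
  push_cast
  field_simp

end Unique

/-! ### Normal modes of a system of coupled oscillators -/

section Modes

variable {ι : Type*} [Fintype ι]

theorem combine_posS_apply (a : ι → ℝ) (g : 𝓢(ι → ℝ, ℂ)) (q : ι → ℝ) :
    combine a (fun x => (posS x).toLinearMap) g q = ((∑ x, a x * q x : ℝ) : ℂ) * g q := by
  simp only [combine_apply, ContinuousLinearMap.coe_coe, sum_apply, smul_apply, posS_apply,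
    smul_eq_mul, Complex.ofReal_sum, Finset.sum_mul, Complex.ofReal_mul, mul_assoc]

/-- The coordinate form of the normal position `Q k`. -/
def modeForm (s : ι → ℝ) (v : ι → ι → ℝ) (k : ι) : (ι → ℝ) →L[ℝ] ℝ :=
  ∑ x, (v k x / s x) • ContinuousLinearMap.proj (R := ℝ) (φ := fun _ : ι => ℝ) x

theorem modeForm_apply (s : ι → ℝ) (v : ι → ι → ℝ) (k : ι) (q : ι → ℝ) :
    modeForm s v k q = ∑ x, v k x / s x * q x := by
  simp [modeForm, sum_apply]

variable [DecidableEq ι]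

/-- The normal modes of `∑ x, s x ^ 2 * p x ^ 2 + ∑ x y, A x y * q x * q y`: frequencies `γ k` and
orthonormal mode vectors `v k`, which diagonalize the matrix with entries `s x * A x y * s y`. -/
structure IsModes (A : Matrix ι ι ℝ) (s : ι → ℝ) (γ : ι → ℝ) (v : ι → ι → ℝ) : Prop where
  s_pos : ∀ x, 0 < s x
  γ_pos : ∀ k, 0 < γ k
  orthonormal : ∀ j k, ∑ x, v j x * v k x = if j = k then 1 else 0
  complete : ∀ x y, ∑ k, v k x * v k y = if x = y then 1 else 0
  diag : ∀ x y, ∑ k, v k x * γ k ^ 2 * v k y = s x * A x y * s y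

theorem combine_momS_apply (c : ι → ℝ) (g : 𝓢(ι → ℝ, ℂ)) (q : ι → ℝ) :
    combine c (fun x => (momS x).toLinearMap) g q =
      -Complex.I * (∂_{c} g : 𝓢(ι → ℝ, ℂ)) q := by
  have hc : c = ∑ x, c x • (Pi.single x 1 : ι → ℝ) := by
    ext y; simp [Finset.sum_apply, Pi.single_apply]
  rw [SchwartzMap.lineDerivOp_apply_eq_fderiv]
  conv_rhs => rw [hc]
  simp only [combine_apply, ContinuousLinearMap.coe_coe, sum_apply, smul_apply, momS_apply,
    smul_eq_mul, SchwartzMap.lineDerivOp_apply_eq_fderiv, map_sum, map_smul, Finset.mul_sum,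
    Complex.real_smul]
  exact Finset.sum_congr rfl fun x _ => by ring

/-- The lowering operator of a mode. -/
def lower (s γ : ι → ℝ) (v : ι → ι → ℝ) (k : ι) : Module.End ℂ 𝓢(ι → ℝ, ℂ) :=
  (γ k : ℂ) • combine (fun x => v k x / s x) (fun x => (posS x).toLinearMap) +
    Complex.I • combine (fun x => s x * v k x) (fun x => (momS x).toLinearMap)

/-- The raising operator of a mode. -/
def raise (s γ : ι → ℝ) (v : ι → ι → ℝ) (k : ι) : Module.End ℂ 𝓢(ι → ℝ, ℂ) :=
  (γ k : ℂ) • combine (fun x => v k x / s x) (fun x => (posS x).toLinearMap) +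
    (-Complex.I) • combine (fun x => s x * v k x) (fun x => (momS x).toLinearMap)

namespace IsModes

variable {A : Matrix ι ι ℝ} {s γ : ι → ℝ} {v : ι → ι → ℝ}

theorem modeForm_dual (h : IsModes A s γ v) (j k : ι) :
    modeForm s v j (fun x => s x * v k x) = if j = k then 1 else 0 := by
  rw [modeForm_apply, ← h.orthonormal j k]
  refine Finset.sum_congr rfl fun x _ => ?_
  have := (h.s_pos x).ne'
  field_simp

theorem sum_modeForm_smul (h : IsModes A s γ v) (q : ι → ℝ) :
    ∑ k, modeForm s v k q • (fun x => s x * v k x) = q := by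
  ext y
  simp only [Finset.sum_apply, Pi.smul_apply, smul_eq_mul, modeForm_apply, Finset.sum_mul]
  rw [Finset.sum_comm]
  have : ∀ x, ∑ k, v k x / s x * q x * (s y * v k y) =
      if x = y then q x / s x * s y else 0 := by
    intro x
    rw [← mul_boole, ← h.complete x y, Finset.mul_sum]
    exact Finset.sum_congr rfl fun k _ => by ring
  simp only [this, Finset.sum_ite_eq', Finset.mem_univ, if_true]
  exact div_mul_cancel₀ _ (h.s_pos y).ne'

theorem span_eq_top (h : IsModes A s γ v) :
    Submodule.span ℝ (Set.range fun k x => s x * v k x) = ⊤ := by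
  refine eq_top_iff.2 fun q _ => ?_
  rw [← h.sum_modeForm_smul q]
  exact Submodule.sum_mem _ fun k _ =>
    Submodule.smul_mem _ _ (Submodule.subset_span ⟨k, rfl⟩)

/-- Expand `q` in the mode directions and apply Cauchy-Schwarz with weights `γ k` and `1 / γ k`.
This is what makes the Gaussian a Schwartz function. -/
theorem coercive (h : IsModes A s γ v) :
    ∃ c > 0, ∀ q, c * ‖q‖ ^ 2 ≤ 1 / 2 * ∑ k, γ k * modeForm s v k q ^ 2 := by
  set W : ℝ := ∑ k, ‖fun x => s x * v k x‖ ^ 2 / γ k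
  have hW : 0 ≤ W := Finset.sum_nonneg fun k _ => div_nonneg (sq_nonneg _) (h.γ_pos k).le
  refine ⟨1 / (2 * (1 + W)), by positivity, fun q => ?_⟩
  have h1 : ‖q‖ ≤ ∑ k, |modeForm s v k q| * ‖fun x => s x * v k x‖ := by
    conv_lhs => rw [← h.sum_modeForm_smul q]
    refine (norm_sum_le _ _).trans (Finset.sum_le_sum fun k _ => ?_)
    rw [norm_smul, Real.norm_eq_abs]
  have h2 := Finset.sum_sq_le_sum_mul_sum_of_sq_le_mul Finset.univ
    (r := fun k => |modeForm s v k q| * ‖fun x => s x * v k x‖)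
    (f := fun k => γ k * modeForm s v k q ^ 2)
    (g := fun k => ‖fun x => s x * v k x‖ ^ 2 / γ k)
    (fun k _ => mul_nonneg (h.γ_pos k).le (sq_nonneg _))
    (fun k _ => div_nonneg (sq_nonneg _) (h.γ_pos k).le)
    (fun k _ => by
      have := (h.γ_pos k).ne'
      rw [mul_pow, sq_abs]
      exact le_of_eq (by field_simp))
  have h3 : 0 ≤ ∑ k, γ k * modeForm s v k q ^ 2 :=
    Finset.sum_nonneg fun k _ => mul_nonneg (h.γ_pos k).le (sq_nonneg _)
  have h4 : ‖q‖ ^ 2 ≤ (∑ k, γ k * modeForm s v k q ^ 2) * (1 + W) :=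
    (pow_le_pow_left₀ (norm_nonneg q) h1 2).trans (h2.trans (by gcongr; linarith))
  rw [div_mul_eq_mul_div, div_le_iff₀ (by positivity)]
  linarith

theorem raise_apply (k : ι) (g : 𝓢(ι → ℝ, ℂ)) (q : ι → ℝ) :
    raise s γ v k g q = ((γ k * modeForm s v k q : ℝ) : ℂ) * g q -
      (∂_{(fun x => s x * v k x : ι → ℝ)} g : 𝓢(ι → ℝ, ℂ)) q := by
  rw [raise, LinearMap.add_apply, LinearMap.smul_apply, LinearMap.smul_apply, add_apply,
    smul_apply, smul_apply, combine_posS_apply, combine_momS_apply, modeForm_apply]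
  simp only [smul_eq_mul, Complex.ofReal_mul]
  linear_combination (∂_{(fun x => s x * v k x : ι → ℝ)} g : 𝓢(ι → ℝ, ℂ)) q * Complex.I_sq

/-- The ground state of the system, up to normalization. -/
def vacuum (h : IsModes A s γ v) : 𝓢(ι → ℝ, ℂ) := gaussianS (modeForm s v) γ h.coercive

/-- The Hamiltonian in normal coordinates. -/
theorem ham_eq (h : IsModes A s γ v) {S : Type*} [AddCommGroup S] [Module ℂ S]
    (q p : ι → Module.End ℂ S) (f : S) :
    ∑ x, ((s x ^ 2 : ℝ) : ℂ) • p x (p x f) + ∑ x, ∑ y, (A x y : ℂ) • q x (q y f) =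
      ∑ k, (combine (fun x => s x * v k x) p (combine (fun x => s x * v k x) p f) +
        ((γ k ^ 2 : ℝ) : ℂ) • combine (fun x => v k x / s x) q
          (combine (fun x => v k x / s x) q f)) := by
  simp only [combine_combine_apply, Finset.sum_add_distrib, Finset.smul_sum, smul_smul]
  congr 1
  · rw [Finset.sum_comm]
    refine Finset.sum_congr rfl fun x _ => ?_
    rw [Finset.sum_comm]
    have : ∀ y, ∑ k, ((s x * v k x * (s y * v k y) : ℝ) : ℂ) • p x (p y f) =
        if x = y then ((s x ^ 2 : ℝ) : ℂ) • p x (p y f) else 0 := by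
      intro y
      rw [← Finset.sum_smul, ← Complex.ofReal_sum,
        show ∑ k, s x * v k x * (s y * v k y) = s x * s y * ∑ k, v k x * v k y by
          rw [Finset.mul_sum]; exact Finset.sum_congr rfl fun k _ => by ring, h.complete]
      split_ifs with hxy
      · subst hxy; rw [mul_one, sq]
      · simp
    simp only [this, Finset.sum_ite_eq, Finset.mem_univ, if_true]
  · symm
    rw [Finset.sum_comm]
    refine Finset.sum_congr rfl fun x _ => ?_
    rw [Finset.sum_comm]
    refine Finset.sum_congr rfl fun y _ => ?_
    rw [← Finset.sum_smul]
    congr 1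
    simp only [← Complex.ofReal_mul, ← Complex.ofReal_sum]
    congr 1
    have hx := (h.s_pos x).ne'
    have hy := (h.s_pos y).ne'
    have : ∑ k, γ k ^ 2 * (v k x / s x * (v k y / s y)) =
        (∑ k, v k x * γ k ^ 2 * v k y) / (s x * s y) := by
      rw [Finset.sum_div]
      exact Finset.sum_congr rfl fun k _ => by field_simp
    rw [this, h.diag]
    field_simp

theorem isLadder (h : IsModes A s γ v) {H : Module.End ℂ 𝓢(ι → ℝ, ℂ)}
    (hH : ∀ f, H f = ∑ x, ((s x ^ 2 : ℝ) : ℂ) • momS x (momS x f) +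
      ∑ x, ∑ y, (A x y : ℂ) • posS x (posS y f)) :
    IsLadder (embS ι) H γ (lower s γ v) (raise s γ v) (∑ k, γ k) h.vacuum := by
  have hccr := (isCCR_schwartz (ι := ι)).combine
    (a := fun k x => v k x / s x) (c := fun k x => s x * v k x) (fun j k => by
      rw [← h.orthonormal j k]
      refine Finset.sum_congr rfl fun x _ => ?_
      have := (h.s_pos x).ne'
      field_simp)
  refine hccr.isLadder γ (fun f => ?_) (fun k => ?_)
  · rw [hH]
    exact h.ham_eq (fun x => (posS x).toLinearMap) (fun x => (momS x).toLinearMap) f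
  · ext q
    rw [add_apply, smul_apply, smul_apply, combine_posS_apply, combine_momS_apply, vacuum,
      lineDerivOp_gaussianS]
    simp only [h.modeForm_dual, mul_ite, mul_one, mul_zero, Finset.sum_ite_eq', Finset.mem_univ,
      if_true, smul_eq_mul, modeForm_apply]
    rw [zero_apply, Complex.ofReal_mul]
    linear_combination ((γ k : ℂ) * ((∑ x, v k x / s x * q x : ℝ) : ℂ) *
      gaussianS (modeForm s v) γ h.coercive q) * Complex.I_sq

/-- In `lower + raise` the momenta cancel and `2 γ k Q_k` remains; completeness of the modes then
recovers `q_x`. -/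
theorem posS_eq (h : IsModes A s γ v) (x : ι) (f : 𝓢(ι → ℝ, ℂ)) :
    posS x f = ∑ k, (((s x * v k x / (2 * γ k) : ℝ) : ℂ) • lower s γ v k f +
      ((s x * v k x / (2 * γ k) : ℝ) : ℂ) • raise s γ v k f) := by
  have h1 : ∀ k, ((s x * v k x / (2 * γ k) : ℝ) : ℂ) • lower s γ v k f +
      ((s x * v k x / (2 * γ k) : ℝ) : ℂ) • raise s γ v k f =
      ∑ y, ((s x / s y * (v k x * v k y) : ℝ) : ℂ) • posS y f := by
    intro k
    rw [← smul_add, lower, raise]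
    simp only [LinearMap.add_apply, LinearMap.smul_apply, neg_smul, LinearMap.neg_apply]
    rw [add_add_add_comm, add_neg_cancel, add_zero, ← two_smul ℂ, smul_smul, smul_smul,
      combine_apply, Finset.smul_sum]
    refine Finset.sum_congr rfl fun y _ => ?_
    rw [smul_smul, ContinuousLinearMap.coe_coe]
    congr 1
    have := (h.γ_pos k).ne'
    rw [show (2 : ℂ) = ((2 : ℝ) : ℂ) by norm_num]
    simp only [← Complex.ofReal_mul]
    congr 1
    field_simp
  simp only [h1]
  rw [Finset.sum_comm]
  simp only [← Finset.sum_smul, ← Complex.ofReal_sum, ← Finset.mul_sum, h.complete]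
  have := (h.s_pos x).ne'
  simp [this]

theorem momS_eq (h : IsModes A s γ v) (x : ι) (f : 𝓢(ι → ℝ, ℂ)) :
    momS x f = ∑ k, ((-Complex.I / 2 * (v k x / s x : ℝ)) • lower s γ v k f +
      (Complex.I / 2 * (v k x / s x : ℝ)) • raise s γ v k f) := by
  have h1 : ∀ k, (-Complex.I / 2 * (v k x / s x : ℝ)) • lower s γ v k f +
      (Complex.I / 2 * (v k x / s x : ℝ)) • raise s γ v k f =
      ∑ y, ((s y / s x * (v k x * v k y) : ℝ) : ℂ) • momS y f := by
    intro k
    have h2 : (-Complex.I / 2 * (v k x / s x : ℝ)) • lower s γ v k f +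
      (Complex.I / 2 * (v k x / s x : ℝ)) • raise s γ v k f =
        ((v k x / s x : ℝ) : ℂ) •
          combine (fun x => s x * v k x) (fun x => (momS x).toLinearMap) f := by
      rw [lower, raise]
      simp only [LinearMap.add_apply, LinearMap.smul_apply]
      match_scalars
      · ring
      · linear_combination (-((v k x : ℂ) / (s x : ℂ))) * Complex.I_sq
    rw [h2, combine_apply, Finset.smul_sum]
    refine Finset.sum_congr rfl fun y _ => ?_
    rw [smul_smul, ContinuousLinearMap.coe_coe, ← Complex.ofReal_mul]
    congr 2
    ring
  simp only [h1]
  rw [Finset.sum_comm]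
  simp only [← Finset.sum_smul, ← Complex.ofReal_sum, ← Finset.mul_sum, h.complete]
  have := (h.s_pos x).ne'
  simp [this]

theorem vacuum_ne_zero (h : IsModes A s γ v) : embS ι h.vacuum ≠ 0 := by
  intro h0
  have h1 : h.vacuum = 0 :=
    SchwartzMap.injective_toLp 2 volume (h0.trans (map_zero (embS ι)).symm)
  have h2 := congrArg (fun f : 𝓢(ι → ℝ, ℂ) => f 0) h1
  simp only [vacuum, gaussianS_apply, zero_apply, Complex.ofReal_eq_zero] at h2
  exact (gaussian_pos _).ne' h2

/-- The Hamiltonian has a ground state, unique up to a phase, which is a vacuum vector of the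
ladder operators. -/
theorem exists_groundState (h : IsModes A s γ v) {H : Module.End ℂ 𝓢(ι → ℝ, ℂ)}
    (hH : ∀ f, H f = ∑ x, ((s x ^ 2 : ℝ) : ℂ) • momS x (momS x f) +
      ∑ x, ∑ y, (A x y : ℂ) • posS x (posS y f)) :
    ∃ Ω : 𝓢(ι → ℝ, ℂ), ‖embS ι Ω‖ = 1 ∧
      IsLadder (embS ι) H γ (lower s γ v) (raise s γ v) (∑ k, γ k) Ω ∧
      groundState (coreClosure (embS ι) H) = embS ι Ω ∧
      IsGroundState (coreClosure (embS ι) H) (embS ι Ω) ∧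
      ∀ Ψ, IsGroundState (coreClosure (embS ι) H) Ψ → ∃ c : ℂ, ‖c‖ = 1 ∧ Ψ = c • embS ι Ω := by
  have hn : ‖embS ι h.vacuum‖ ≠ 0 := norm_ne_zero_iff.2 h.vacuum_ne_zero
  set Ω₀ : 𝓢(ι → ℝ, ℂ) := ((‖embS ι h.vacuum‖⁻¹ : ℝ) : ℂ) • h.vacuum with hΩ₀
  have hnorm : ‖embS ι Ω₀‖ = 1 := by
    rw [hΩ₀, map_smul, norm_smul, Complex.norm_real, norm_inv, norm_norm, inv_mul_cancel₀ hn]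
  have hl := (h.isLadder hH).smul ((‖embS ι h.vacuum‖⁻¹ : ℝ) : ℂ)
  rw [← hΩ₀] at hl
  have huniq : ∀ Ψ, IsGroundState (coreClosure (embS ι) H) Ψ →
      ∃ c : ℂ, ‖c‖ = 1 ∧ Ψ = c • embS ι Ω₀ := by
    intro Ψ hΨ
    obtain ⟨c, hc⟩ := eq_smul_gaussianS h.coercive h.span_eq_top h.modeForm_dual
      (bd := raise s γ v) raise_apply (hl.inner_raise_eq_zero denseRange_embS hnorm hΨ)
    have h2 : Ψ = (c * ‖embS ι h.vacuum‖) • embS ι Ω₀ := by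
      rw [hΩ₀, map_smul, smul_smul, hc, mul_assoc, ← Complex.ofReal_mul, mul_inv_cancel₀ hn,
        Complex.ofReal_one, mul_one]
      rfl
    refine ⟨_, ?_, h2⟩
    have h3 := hΨ.1
    rwa [h2, norm_smul, hnorm, mul_one] at h3
  -- `groundState` is an arbitrary choice. Uniqueness identifies it with the normalized Gaussian up
  -- to a phase, which is absorbed into `Ω`.
  have hgs : IsGroundState (coreClosure (embS ι) H) (groundState (coreClosure (embS ι) H)) :=
    Classical.epsilon_spec ⟨_, hl.isGroundState denseRange_embS hnorm⟩
  obtain ⟨c, hc1, hc⟩ := huniq _ hgs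
  have hc0 : c ≠ 0 := norm_ne_zero_iff.1 (by rw [hc1]; exact one_ne_zero)
  have hcΩ : groundState (coreClosure (embS ι) H) = embS ι (c • Ω₀) := by
    rw [hc, map_smul (embS ι) c]
  refine ⟨c • Ω₀, by rw [map_smul, norm_smul, hc1, hnorm, mul_one], hl.smul c, hcΩ,
    hcΩ ▸ hgs, fun Ψ hΨ => ?_⟩
  obtain ⟨c', hc1', rfl⟩ := huniq Ψ hΨ
  refine ⟨c' * c⁻¹, by rw [norm_mul, norm_inv, hc1, hc1', inv_one, mul_one], ?_⟩
  rw [map_smul (embS ι) c, smul_smul, mul_assoc, inv_mul_cancel₀ hc0, mul_one]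

end IsModes

end Modes

/-! ### Eigenvector expansions -/

section MatFun

variable {n : Type*} [Fintype n] [DecidableEq n] {A : Matrix n n ℝ}

theorem sum_eigenvector_mul (hA : A.IsHermitian) (j k : n) :
    ∑ x, hA.eigenvectorBasis j x * hA.eigenvectorBasis k x = if j = k then 1 else 0 := by
  rw [← orthonormal_iff_ite.1 hA.eigenvectorBasis.orthonormal j k, PiLp.inner_apply]
  simp [mul_comm]

theorem sum_eigenvector_mul' (hA : A.IsHermitian) (x y : n) :
    ∑ k, hA.eigenvectorBasis k x * hA.eigenvectorBasis k y = if x = y then 1 else 0 := by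
  have := hA.eigenvectorBasis.sum_inner_mul_inner (EuclideanSpace.single x 1)
    (EuclideanSpace.single y 1)
  simpa [EuclideanSpace.inner_single_left, EuclideanSpace.inner_single_right, Pi.single_apply,
    eq_comm] using this

theorem sum_eigenvector_pow (hA : A.IsHermitian) (j : ℕ) (x y : n) :
    ∑ k, hA.eigenvectorBasis k x * hA.eigenvalues k ^ j * hA.eigenvectorBasis k y =
      (A ^ j) x y := by
  induction j generalizing x with
  | zero => simp [sum_eigenvector_mul' hA, Matrix.one_apply]
  | succ j ih =>
    have h1 : ∀ k x, ∑ z, A x z * hA.eigenvectorBasis k z =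
        hA.eigenvalues k * hA.eigenvectorBasis k x := fun k x =>
      congrFun (hA.mulVec_eigenvectorBasis k) x
    rw [pow_succ', Matrix.mul_apply]
    simp only [← ih, Finset.mul_sum]
    rw [Finset.sum_comm]
    refine Finset.sum_congr rfl fun k _ => ?_
    rw [pow_succ', show hA.eigenvectorBasis k x * (hA.eigenvalues k * hA.eigenvalues k ^ j) *
      hA.eigenvectorBasis k y = (hA.eigenvalues k * hA.eigenvectorBasis k x) *
        (hA.eigenvalues k ^ j * hA.eigenvectorBasis k y) by ring, ← h1, Finset.sum_mul]
    exact Finset.sum_congr rfl fun z _ => by ring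

/-- The right-hand side no longer mentions eigenvectors, which makes it visibly measurable in the
matrix. -/
theorem sum_eigenvector_polynomial (hA : A.IsHermitian) (p : Polynomial ℝ) (x y : n) :
    ∑ k, hA.eigenvectorBasis k x * p.eval (hA.eigenvalues k) * hA.eigenvectorBasis k y =
      ∑ j ∈ Finset.range (p.natDegree + 1), p.coeff j * (A ^ j) x y := by
  simp only [← sum_eigenvector_pow hA, Polynomial.eval_eq_sum_range, Finset.mul_sum,
    Finset.sum_mul]
  rw [Finset.sum_comm]
  exact Finset.sum_congr rfl fun j _ => Finset.sum_congr rfl fun k _ => by ring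

theorem matFun_congr (hA : A.IsHermitian) {f g : ℝ → ℂ}
    (h : ∀ k, f (hA.eigenvalues k) = g (hA.eigenvalues k)) (x y : n) :
    matFun hA f x y = matFun hA g x y := by
  simp only [matFun, h]

theorem matFun_const_mul (hA : A.IsHermitian) (c : ℂ) (f : ℝ → ℂ) (x y : n) :
    matFun hA (fun s => c * f s) x y = c * matFun hA f x y := by
  simp only [matFun, Finset.mul_sum]
  exact Finset.sum_congr rfl fun k _ => by ring

end MatFun

/-! ### Measurability of functions of random matrices -/

section Measurability

variable {Ω : Type*} [MeasurableSpace Ω] {ℙ : Measure Ω} {n : Type*} [Fintype n] [DecidableEq n]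
  {A : Ω → Matrix n n ℝ}

theorem measurable_pow_apply (hA : ∀ x y, Measurable fun ω => A ω x y) (j : ℕ) (x y : n) :
    Measurable fun ω => (A ω ^ j) x y := by
  induction j generalizing x with
  | zero => simp only [pow_zero]; exact measurable_const
  | succ j ih =>
    simp only [pow_succ', Matrix.mul_apply]
    exact Finset.measurable_sum _ fun z _ => (hA x z).mul (ih z)

/-- There is a sequence of polynomials that converges pointwise to a given continuous function on
the positive half line. -/
theorem exists_polynomial_tendsto {f : ℝ → ℝ} (hf : ContinuousOn f (Set.Ioi 0)) :
    ∃ p : ℕ → Polynomial ℝ, ∀ x, 0 < x →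
      Filter.Tendsto (fun N => (p N).eval x) Filter.atTop (nhds (f x)) := by
  -- Weierstrass on compact intervals exhausting the half line; `f` may be singular at `0`, as `s ^
  -- (-1/2)` is.
  have hex : ∀ N : ℕ, ∃ p : Polynomial ℝ, ∀ x ∈ Set.Icc (1 / (N + 1 : ℝ)) (N : ℝ),
      |p.eval x - f x| < 1 / (N + 1 : ℝ) := by
    intro N
    have hN : (0 : ℝ) < 1 / (N + 1 : ℝ) := by positivity
    exact exists_polynomial_near_of_continuousOn _ _ f
      (hf.mono fun x hx => hN.trans_le hx.1) _ hN
  choose p hp using hex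
  refine ⟨p, fun x hx => ?_⟩
  rw [tendsto_iff_dist_tendsto_zero]
  have hlim := tendsto_one_div_add_atTop_nhds_zero_nat (𝕜 := ℝ)
  refine squeeze_zero' (Filter.Eventually.of_forall fun N => dist_nonneg) ?_ hlim
  filter_upwards [hlim.eventually (gt_mem_nhds hx), Filter.eventually_ge_atTop ⌈x⌉₊]
    with N h1 h2
  exact (hp N x ⟨h1.le, (Nat.le_ceil x).trans (by exact_mod_cast h2)⟩).le

theorem aemeasurable_sum_eigenvector (hA : ∀ x y, Measurable fun ω => A ω x y)
    (hH : ∀ ω, (A ω).IsHermitian) (hpos : ∀ᵐ ω ∂ℙ, ∀ k, 0 < (hH ω).eigenvalues k) {f : ℝ → ℝ}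
    (hf : ContinuousOn f (Set.Ioi 0)) (x y : n) :
    AEMeasurable (fun ω => ∑ k, (hH ω).eigenvectorBasis k x * f ((hH ω).eigenvalues k) *
      (hH ω).eigenvectorBasis k y) ℙ := by
  obtain ⟨p, hp⟩ := exists_polynomial_tendsto hf
  refine aemeasurable_of_tendsto_metrizable_ae Filter.atTop
    (f := fun N ω => ∑ k, (hH ω).eigenvectorBasis k x * (p N).eval ((hH ω).eigenvalues k) *
      (hH ω).eigenvectorBasis k y) (fun N => ?_) ?_
  · simp only [sum_eigenvector_polynomial]
    exact (Finset.measurable_sum _ fun j _ =>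
      (measurable_pow_apply hA j x y).const_mul _).aemeasurable
  · filter_upwards [hpos] with ω hω
    exact tendsto_finsetSum _ fun k _ => ((hp _ (hω k)).const_mul _).mul_const _

theorem aemeasurable_matFun (hA : ∀ x y, Measurable fun ω => A ω x y)
    (hH : ∀ ω, (A ω).IsHermitian) (hpos : ∀ᵐ ω ∂ℙ, ∀ k, 0 < (hH ω).eigenvalues k) {f : ℝ → ℂ}
    (hf : ContinuousOn f (Set.Ioi 0)) (x y : n) :
    AEMeasurable (fun ω => matFun (hH ω) f x y) ℙ := by
  have h1 := aemeasurable_sum_eigenvector hA hH hpos (f := fun s => (f s).re)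
    (Complex.continuous_re.comp_continuousOn hf) x y
  have h2 := aemeasurable_sum_eigenvector hA hH hpos (f := fun s => (f s).im)
    (Complex.continuous_im.comp_continuousOn hf) x y
  have := (Complex.measurable_ofReal.comp_aemeasurable h1).add
    ((Complex.measurable_ofReal.comp_aemeasurable h2).mul_const Complex.I)
  refine this.congr (Filter.Eventually.of_forall fun ω => ?_)
  simp only [Pi.add_apply, Function.comp_apply, matFun, Complex.ofReal_sum, Finset.sum_mul,
    ← Finset.sum_add_distrib]
  refine Finset.sum_congr rfl fun k _ => ?_
  conv_rhs => rw [← Complex.re_add_im (f ((hH ω).eigenvalues k))]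
  push_cast
  ring

theorem iSup_real_eq_iSup_rat {F : ℝ → ℝ≥0∞} (hF : Continuous F) :
    ⨆ t : ℝ, F t = ⨆ t : ℚ, F t := by
  refine le_antisymm (iSup_le fun t => ?_) (iSup_le fun t => le_iSup F (t : ℝ))
  have hcl : IsClosed {t : ℝ | F t ≤ ⨆ t : ℚ, F t} := isClosed_le hF continuous_const
  have hd : Dense {t : ℝ | F t ≤ ⨆ t : ℚ, F t} := Rat.denseRange_cast.mono (by
    rintro _ ⟨t, rfl⟩
    exact le_iSup (fun t : ℚ => F t) t)
  have : t ∈ closure {t : ℝ | F t ≤ ⨆ t : ℚ, F t} := hd t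
  rwa [hcl.closure_eq] at this

/-- Continuity in `t` reduces the uncountable supremum to rational times. -/
theorem aemeasurable_iSup_real {F : ℝ → Ω → ℝ≥0∞} (hF : ∀ t, AEMeasurable (F t) ℙ)
    (hc : ∀ᵐ ω ∂ℙ, Continuous fun t => F t ω) : AEMeasurable (fun ω => ⨆ t, F t ω) ℙ := by
  refine (AEMeasurable.iSup fun t : ℚ => hF t).congr ?_
  filter_upwards [hc] with ω hω
  exact (iSup_real_eq_iSup_rat hω).symm

end Measurability

namespace Params

variable {d : ℕ} (P : Params d) (L : ℕ)

/-! ### The one-particle Hamiltonian -/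

/-- The coupling of two sites, zero unless they are nearest neighbours. -/
def coupling (x y : box d L) : ℝ := if dist1 x.1 y.1 = 1 then P.lam s(x.1, y.1) else 0

theorem coupling_comm (x y : box d L) : P.coupling L x y = P.coupling L y x := by
  simp only [coupling, dist1_comm x.1 y.1, Sym2.eq_swap (a := x.1) (b := y.1)]

theorem coupling_self (x : box d L) : P.coupling L x x = 0 := by
  simp [coupling, dist1]

theorem h0_apply (x y : box d L) : P.h0 L x y =
    (if x = y then P.k x / 2 + ∑ u, P.coupling L x u else 0) - P.coupling L x y := by
  by_cases hxy : x = y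
  · subst hxy
    simp only [h0, if_true, coupling_self, sub_zero]
    congr 1
    refine Finset.sum_congr rfl fun u _ => ?_
    simp only [coupling, dist1_comm u.1 x.1]
  · simp only [h0, if_neg hxy, coupling]
    split_ifs <;> simp

/-- The potential energy as a quadratic form. -/
theorem sum_h0 (w : box d L → ℝ) : ∑ x, ∑ y, P.h0 L x y * w x * w y =
    ∑ x : box d L, P.k x / 2 * w x ^ 2 + 1 / 2 * ∑ x, ∑ y, P.coupling L x y * (w x - w y) ^ 2 := by
  have h1 : ∑ x, ∑ y, P.coupling L x y * w y ^ 2 = ∑ x, ∑ y, P.coupling L x y * w x ^ 2 := by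
    rw [Finset.sum_comm]
    exact Finset.sum_congr rfl fun x _ => Finset.sum_congr rfl fun y _ => by
      rw [coupling_comm]
  have h2 : ∑ x, ∑ y, P.coupling L x y * (w x - w y) ^ 2 =
      ∑ x, ∑ y, P.coupling L x y * w x ^ 2 + ∑ x, ∑ y, P.coupling L x y * w y ^ 2 -
        2 * ∑ x, ∑ y, P.coupling L x y * w x * w y := by
    simp only [Finset.mul_sum, ← Finset.sum_add_distrib, ← Finset.sum_sub_distrib]
    exact Finset.sum_congr rfl fun x _ => Finset.sum_congr rfl fun y _ => by ring
  have h3 : ∀ x, ∑ y, P.h0 L x y * w x * w y =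
      P.k x / 2 * w x ^ 2 + ∑ y, P.coupling L x y * w x ^ 2 -
        ∑ y, P.coupling L x y * w x * w y := by
    intro x
    simp only [h0_apply, sub_mul, ite_mul, zero_mul, Finset.sum_sub_distrib, Finset.sum_ite_eq,
      Finset.mem_univ, if_true, ← Finset.sum_mul]
    ring
  simp only [h3, Finset.sum_add_distrib, Finset.sum_sub_distrib]
  rw [h2, h1]
  ring

theorem h_apply (x y : box d L) : P.h L x y =
    Real.sqrt (1 / (2 * P.m x)) * P.h0 L x y * Real.sqrt (1 / (2 * P.m y)) := by
  simp only [h, sqrtMu, Matrix.mul_diagonal, Matrix.diagonal_mul]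

/-- The Hamiltonian in terms of the matrix `h0`. -/
theorem hamiltonianS_apply (hm : ∀ x, 0 < P.m x) (f : 𝓢(box d L → ℝ, ℂ)) :
    P.hamiltonianS L f =
      ∑ x : box d L, ((Real.sqrt (1 / (2 * P.m x)) ^ 2 : ℝ) : ℂ) • momS x (momS x f) +
        ∑ x, ∑ y, (P.h0 L x y : ℂ) • posS x (posS y f) := by
  have hs : ∀ x, Real.sqrt (1 / (2 * P.m x)) ^ 2 = 1 / (2 * P.m x) := fun x =>
    Real.sq_sqrt (by have := hm x; positivity)
  ext q
  have h1 : ∑ x, ∑ y, (P.h0 L x y : ℂ) * (q x * (q y * f q)) =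
      ((∑ x, ∑ y, P.h0 L x y * q x * q y : ℝ) : ℂ) * f q := by
    push_cast
    simp only [Finset.sum_mul]
    exact Finset.sum_congr rfl fun x _ => Finset.sum_congr rfl fun y _ => by ring
  have h2 : ∀ x y : box d L, ((if dist1 x.1 y.1 = 1 then
      ((P.lam s(x.1, y.1) : ℝ) : ℂ) • ((posS x - posS y) ∘L (posS x - posS y)) else 0 :
        𝓢(box d L → ℝ, ℂ) →L[ℂ] 𝓢(box d L → ℝ, ℂ)) f) q =
      ((P.coupling L x y * (q x - q y) ^ 2 : ℝ) : ℂ) * f q := by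
    intro x y
    rw [coupling]
    split_ifs
    · simp only [smul_apply, ContinuousLinearMap.comp_apply, sub_apply, posS_apply, smul_eq_mul]
      push_cast
      ring
    · simp
  simp only [hamiltonianS, add_apply, sum_apply, smul_apply, ContinuousLinearMap.comp_apply, h2,
    hs, smul_eq_mul, posS_apply, h1, sum_h0]
  rw [Finset.sum_add_distrib, add_assoc]
  congr 1
  push_cast
  simp only [add_mul, Finset.sum_mul, Finset.mul_sum]
  congr 1
  · exact Finset.sum_congr rfl fun x _ => by ring
  · exact Finset.sum_congr rfl fun x _ => Finset.sum_congr rfl fun y _ => by ring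

theorem h_posDef (hm : ∀ x, 0 < P.m x) (hpd : (P.h0 L).PosDef) : (P.h L).PosDef := by
  have hs : (P.sqrtMu L).conjTranspose = P.sqrtMu L := by simp [sqrtMu]
  have := hpd.conjTranspose_mul_mul_same (B := P.sqrtMu L) (by
    intro v w hvw
    ext x
    have h1 := congrFun hvw x
    simp only [sqrtMu, Matrix.mulVec_diagonal] at h1
    have h2 : Real.sqrt (1 / (2 * P.m x)) ≠ 0 := by
      have := hm x
      positivity
    exact mul_left_cancel₀ h2 h1)
  rwa [hs] at this

theorem eigenvalues_pos (hm : ∀ x, 0 < P.m x) (hpd : (P.h0 L).PosDef) (k : box d L) :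
    0 < (P.h_isHermitian L).eigenvalues k :=
  (P.h_posDef L hm hpd).eigenvalues_pos k

theorem isModes (hm : ∀ x, 0 < P.m x) (hpd : (P.h0 L).PosDef) :
    IsModes (P.h0 L) (fun x => Real.sqrt (1 / (2 * P.m x)))
      (fun k => Real.sqrt ((P.h_isHermitian L).eigenvalues k))
      (fun k x => (P.h_isHermitian L).eigenvectorBasis k x) where
  s_pos x := by
    have := hm x
    positivity
  γ_pos k := Real.sqrt_pos.2 (P.eigenvalues_pos L hm hpd k)
  orthonormal := sum_eigenvector_mul _
  complete := sum_eigenvector_mul' _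
  diag x y := by
    rw [← h_apply]
    simp only [Real.sq_sqrt (P.eigenvalues_pos L hm hpd _).le]
    simpa using sum_eigenvector_pow (P.h_isHermitian L) 1 x y

/-! ### A uniform bound on the spectrum -/

/-- Neighbours lie in the cube of side three around `x`; only independence of `L` matters. -/
theorem card_neighbours_le (x : box d L) :
    (Finset.univ.filter fun y : box d L => dist1 x.1 y.1 = 1).card ≤ 3 ^ d := by
  have h1 : (Finset.univ.filter fun y : box d L => dist1 x.1 y.1 = 1).card ≤
      (Finset.Icc (x.1 - 1) (x.1 + 1)).card := by
    refine Finset.card_le_card_of_injOn Subtype.val (fun y hy => ?_)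
      Subtype.val_injective.injOn
    have hy : dist1 x.1 y.1 = 1 := by simpa using hy
    have habs : ∀ i, |x.1 i - y.1 i| ≤ 1 := fun i => by
      rw [← hy]
      exact Finset.single_le_sum (f := fun i => |x.1 i - y.1 i|) (fun _ _ => abs_nonneg _)
        (Finset.mem_univ i)
    simp only [Finset.coe_Icc, Set.mem_Icc, Pi.le_def, Pi.sub_apply, Pi.add_apply, Pi.one_apply]
    exact ⟨fun i => by have := abs_le.1 (habs i); omega,
      fun i => by have := abs_le.1 (habs i); omega⟩
  refine h1.trans (le_of_eq ?_)
  rw [Pi.card_Icc]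
  have h2 : ∀ i, (Finset.Icc ((x.1 - 1) i) ((x.1 + 1) i)).card = 3 := by
    intro i
    rw [Int.card_Icc, Pi.add_apply, Pi.sub_apply, Pi.one_apply]
    omega
  rw [Finset.prod_congr rfl fun i _ => h2 i, Finset.prod_const, Finset.card_univ,
    Fintype.card_fin]

/-- A bound on the spectrum of `h`. -/
def specBound (d : ℕ) (mmin kmax lammax : ℝ) : ℝ :=
  1 + (|kmax| / 2 + 2 * (3 ^ d * |lammax|)) * (1 / (2 * mmin))

variable {P L} {mmin mmax kmax lammax : ℝ}

theorem specBound_pos (hmmin : 0 < mmin) : 0 < specBound d mmin kmax lammax := by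
  unfold specBound
  positivity

theorem Bounded.m_pos (hb : P.Bounded mmin mmax kmax lammax) (hmmin : 0 < mmin)
    (x : Fin d → ℤ) : 0 < P.m x := hmmin.trans_le (hb.1 x).1

/-- The eigenvalue is the form of `h0` at `μ^{1/2} v`. Use `(a - b)² ≤ 2 a² + 2 b²` in the coupling
energy, then the bounded number of neighbours and the lower bound on the masses. -/
theorem Bounded.eigenvalues_le (hb : P.Bounded mmin mmax kmax lammax) (hmmin : 0 < mmin)
    (k : box d L) : (P.h_isHermitian L).eigenvalues k ≤ specBound d mmin kmax lammax := by
  set v : box d L → ℝ := fun x => (P.h_isHermitian L).eigenvectorBasis k x with hv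
  set w : box d L → ℝ := fun x => Real.sqrt (1 / (2 * P.m x)) * v x with hw
  have hvv : ∑ x, v x ^ 2 = 1 := by
    have := sum_eigenvector_mul (P.h_isHermitian L) k k
    simpa [sq] using this
  have h1 : (P.h_isHermitian L).eigenvalues k = ∑ x, ∑ y, P.h0 L x y * w x * w y := by
    have h2 : ∀ x, ∑ y, P.h L x y * v y = (P.h_isHermitian L).eigenvalues k * v x := fun x =>
      congrFun ((P.h_isHermitian L).mulVec_eigenvectorBasis k) x
    calc (P.h_isHermitian L).eigenvalues k
        = ∑ x, v x * ((P.h_isHermitian L).eigenvalues k * v x) := by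
          conv_lhs => rw [← mul_one ((P.h_isHermitian L).eigenvalues k), ← hvv, Finset.mul_sum]
          exact Finset.sum_congr rfl fun x _ => by ring
      _ = _ := by
          simp only [← h2, Finset.mul_sum, h_apply, hw]
          exact Finset.sum_congr rfl fun x _ => Finset.sum_congr rfl fun y _ => by ring
  have hc : ∀ x y, 0 ≤ P.coupling L x y := by
    intro x y
    rw [coupling]
    split_ifs with hxy
    · exact (hb.2.2 _ _ hxy).1
    · exact le_rfl
  have hcs : ∀ x, ∑ y, P.coupling L x y ≤ 3 ^ d * |lammax| := by
    intro x
    simp only [coupling]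
    rw [← Finset.sum_filter]
    refine (Finset.sum_le_card_nsmul _ _ |lammax| fun y hy => ?_).trans ?_
    · exact (hb.2.2 _ _ (by simpa using hy)).2.trans (le_abs_self _)
    · rw [nsmul_eq_mul]
      gcongr
      exact_mod_cast card_neighbours_le L x
  have h3 : ∑ x, ∑ y, P.coupling L x y * (w x - w y) ^ 2 ≤
      4 * ∑ x, (∑ y, P.coupling L x y) * w x ^ 2 := by
    have h4 : ∑ x, ∑ y, P.coupling L x y * w y ^ 2 = ∑ x, ∑ y, P.coupling L x y * w x ^ 2 := by
      rw [Finset.sum_comm]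
      exact Finset.sum_congr rfl fun x _ => Finset.sum_congr rfl fun y _ => by
        rw [coupling_comm]
    calc ∑ x, ∑ y, P.coupling L x y * (w x - w y) ^ 2
        ≤ ∑ x, ∑ y, (2 * (P.coupling L x y * w x ^ 2) + 2 * (P.coupling L x y * w y ^ 2)) := by
          refine Finset.sum_le_sum fun x _ => Finset.sum_le_sum fun y _ => ?_
          nlinarith [mul_nonneg (hc x y) (sq_nonneg (w x + w y))]
      _ = _ := by
          simp only [Finset.sum_add_distrib, ← Finset.mul_sum]
          rw [h4]
          simp only [Finset.sum_mul]
          ring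
  have h5 : ∀ x, w x ^ 2 ≤ 1 / (2 * mmin) * v x ^ 2 := by
    intro x
    have hmx := hb.m_pos hmmin x
    rw [hw, mul_pow, Real.sq_sqrt (by positivity)]
    gcongr
    exact (hb.1 x).1
  have h6 : ∑ x, w x ^ 2 ≤ 1 / (2 * mmin) := by
    calc ∑ x, w x ^ 2 ≤ ∑ x, 1 / (2 * mmin) * v x ^ 2 := Finset.sum_le_sum fun x _ => h5 x
      _ = _ := by rw [← Finset.mul_sum, hvv, mul_one]
  rw [h1, sum_h0, specBound]
  calc ∑ x : box d L, P.k x / 2 * w x ^ 2 +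
        1 / 2 * ∑ x, ∑ y, P.coupling L x y * (w x - w y) ^ 2
      ≤ ∑ x, |kmax| / 2 * w x ^ 2 + 1 / 2 * (4 * ∑ x, (3 ^ d * |lammax|) * w x ^ 2) := by
        gcongr with x _
        · exact (hb.2.1 x).2.trans (le_abs_self _)
        · refine h3.trans ?_
          gcongr with x _
          exact hcs x
    _ = (|kmax| / 2 + 2 * (3 ^ d * |lammax|)) * ∑ x, w x ^ 2 := by
        rw [← Finset.mul_sum, ← Finset.mul_sum]; ring
    _ ≤ (|kmax| / 2 + 2 * (3 ^ d * |lammax|)) * (1 / (2 * mmin)) := by gcongr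
    _ ≤ _ := by linarith

end Params

/-- The phase `e^{-2it√s}`. -/
def phase (t s : ℝ) : ℂ := Complex.exp (-(2 * Complex.I * Real.sqrt s * t))

theorem norm_phase (t s : ℝ) : ‖phase t s‖ = 1 := by
  rw [phase, Complex.norm_exp]
  simp

theorem continuous_phase_left (s : ℝ) : Continuous fun t => phase t s := by
  unfold phase
  fun_prop

theorem continuous_phase_right (t : ℝ) : Continuous (phase t) := by
  unfold phase
  have : Continuous fun s : ℝ => ((Real.sqrt s : ℝ) : ℂ) :=
    Complex.continuous_ofReal.comp Real.continuous_sqrt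
  fun_prop

theorem continuous_matFun_phase {n : Type*} [Fintype n] [DecidableEq n] {A : Matrix n n ℝ}
    (hA : A.IsHermitian) (f : ℝ → ℂ) (x y : n) :
    Continuous fun t => matFun hA (fun s => f s * phase t s) x y := by
  unfold matFun
  exact continuous_finsetSum _ fun k _ => (continuous_const.mul
    (continuous_const.mul (continuous_phase_left _))).mul continuous_const

namespace Params

variable {d : ℕ} (P : Params d) (L : ℕ)

/-! ### Dynamic ground state correlations -/

/-- The matrix entry `μ_x^{1/2}`. -/
def muSqrt (x : box d L) : ℝ := Real.sqrt (1 / (2 * P.m x))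

/-- A position contributes `1 / (2 γ k)` per mode, a momentum `±i / 2`, and the commutator `2 γ k`;
the net power of `γ k = √(eigenvalue)` is `-1`, `0` or `1`. -/
theorem exists_mem_dynOp_graph (hm : ∀ x, 0 < P.m x) (hpd : (P.h0 L).PosDef) :
    IsGroundState (P.hamiltonian L) (P.gs L) ∧
    (∀ Ψ, IsGroundState (P.hamiltonian L) Ψ → ∃ c : ℂ, ‖c‖ = 1 ∧ Ψ = c • P.gs L) ∧
    ∀ (t : ℝ) (x y : box d L),
      (∃ Φ, (P.gs L, Φ) ∈ (P.dynOp L t (posOp x) (posOp y)).graph ∧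
        inner ℂ (P.gs L) Φ = ((P.muSqrt L x * P.muSqrt L y / 2 : ℝ) : ℂ) *
          matFun (P.h_isHermitian L) (fun s => ((s ^ (-1 / 2 : ℝ) : ℝ) : ℂ) * phase t s) x y) ∧
      (∃ Φ, (P.gs L, Φ) ∈ (P.dynOp L t (posOp x) (momOp y)).graph ∧
        inner ℂ (P.gs L) Φ = (Complex.I * (P.muSqrt L x / P.muSqrt L y / 2 : ℝ)) *
          matFun (P.h_isHermitian L) (fun s => ((s ^ (0 : ℝ) : ℝ) : ℂ) * phase t s) x y) ∧
      (∃ Φ, (P.gs L, Φ) ∈ (P.dynOp L t (momOp x) (posOp y)).graph ∧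
        inner ℂ (P.gs L) Φ = (-Complex.I * (P.muSqrt L y / P.muSqrt L x / 2 : ℝ)) *
          matFun (P.h_isHermitian L) (fun s => ((s ^ (0 : ℝ) : ℝ) : ℂ) * phase t s) x y) ∧
      (∃ Φ, (P.gs L, Φ) ∈ (P.dynOp L t (momOp x) (momOp y)).graph ∧
        inner ℂ (P.gs L) Φ = ((1 / (P.muSqrt L x * P.muSqrt L y) / 2 : ℝ) : ℂ) *
          matFun (P.h_isHermitian L) (fun s => ((Real.sqrt s : ℝ) : ℂ) * phase t s) x y) := by
  have hM := P.isModes L hm hpd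
  obtain ⟨Ω, hΩ, hl, hgs, hground, huniq⟩ :=
    hM.exists_groundState (H := (P.hamiltonianS L).toLinearMap) (P.hamiltonianS_apply L hm)
  -- `closureOfSchwartz` unfolds to `coreClosure` over `embS`, so the abstract results apply
  -- definitionally.
  have hgs' : P.gs L = embS _ Ω := hgs
  have hs : ∀ x, P.muSqrt L x ≠ 0 := fun x => (hM.s_pos x).ne'
  have hγ : ∀ k, Real.sqrt ((P.h_isHermitian L).eigenvalues k) ≠ 0 := fun k => (hM.γ_pos k).ne'
  have hmat : ∀ (c : ℂ) (f : ℝ → ℂ) (t : ℝ) (x y : box d L) (a b : box d L → ℂ),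
      (∀ k, ((2 * Real.sqrt ((P.h_isHermitian L).eigenvalues k) : ℝ) : ℂ) * a k * b k =
        c * ((P.h_isHermitian L).eigenvectorBasis k x * f ((P.h_isHermitian L).eigenvalues k) *
          (P.h_isHermitian L).eigenvectorBasis k y)) →
      ∑ k, ((2 * Real.sqrt ((P.h_isHermitian L).eigenvalues k) : ℝ) : ℂ) * a k * b k *
        Complex.exp (-(2 * Complex.I * Real.sqrt ((P.h_isHermitian L).eigenvalues k) * t)) =
      c * matFun (P.h_isHermitian L) (fun s => f s * phase t s) x y := by
    intro c f t x y a b hab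
    rw [matFun, Finset.mul_sum]
    refine Finset.sum_congr rfl fun k _ => ?_
    rw [hab k, phase]
    ring
  rw [hgs']
  refine ⟨hground, huniq, fun t x y => ⟨?_, ?_, ?_, ?_⟩⟩
  · obtain ⟨Φ, h1, h2⟩ := hl.exists_mem_dyn_graph denseRange_embS hΩ (formalAdjoint_posS x)
      (formalAdjoint_posS y) (hM.posS_eq x) (hM.posS_eq y) t
    refine ⟨Φ, h1, h2.trans (hmat _ _ t x y _ _ fun k => ?_)⟩
    have h3 : (P.h_isHermitian L).eigenvalues k ^ (-1 / 2 : ℝ) =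
        (Real.sqrt ((P.h_isHermitian L).eigenvalues k))⁻¹ := by
      rw [neg_div, Real.rpow_neg (P.eigenvalues_pos L hm hpd k).le, Real.sqrt_eq_rpow]
    rw [h3]
    simp only [← Complex.ofReal_mul]
    congr 1
    have := hγ k
    simp only [muSqrt]
    field_simp
  · obtain ⟨Φ, h1, h2⟩ := hl.exists_mem_dyn_graph denseRange_embS hΩ (formalAdjoint_posS x)
      (formalAdjoint_momS y) (hM.posS_eq x) (hM.momS_eq y) t
    refine ⟨Φ, h1, h2.trans (hmat _ _ t x y _ _ fun k => ?_)⟩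
    have h4 : ((Real.sqrt ((P.h_isHermitian L).eigenvalues k) : ℝ) : ℂ) ≠ 0 := by
      exact_mod_cast hγ k
    rw [Real.rpow_zero]
    simp only [muSqrt]
    push_cast
    field_simp
  · obtain ⟨Φ, h1, h2⟩ := hl.exists_mem_dyn_graph denseRange_embS hΩ (formalAdjoint_momS x)
      (formalAdjoint_posS y) (hM.momS_eq x) (hM.posS_eq y) t
    refine ⟨Φ, h1, h2.trans (hmat _ _ t x y _ _ fun k => ?_)⟩
    have h4 : ((Real.sqrt ((P.h_isHermitian L).eigenvalues k) : ℝ) : ℂ) ≠ 0 := by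
      exact_mod_cast hγ k
    rw [Real.rpow_zero]
    simp only [muSqrt]
    push_cast
    field_simp
  · obtain ⟨Φ, h1, h2⟩ := hl.exists_mem_dyn_graph denseRange_embS hΩ (formalAdjoint_momS x)
      (formalAdjoint_momS y) (hM.momS_eq x) (hM.momS_eq y) t
    refine ⟨Φ, h1, h2.trans (hmat _ _ t x y _ _ fun k => ?_)⟩
    simp only [muSqrt]
    push_cast
    linear_combination (-(1 / 2) * (Real.sqrt ((P.h_isHermitian L).eigenvalues k) : ℂ) *
      ((P.h_isHermitian L).eigenvectorBasis k x / (Real.sqrt (1 / (2 * P.m x)) : ℂ)) *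
      ((P.h_isHermitian L).eigenvectorBasis k y / (Real.sqrt (1 / (2 * P.m y)) : ℂ))) *
        Complex.I_sq

variable {P L}

theorem corr_pos_pos (hm : ∀ x, 0 < P.m x) (hpd : (P.h0 L).PosDef) (t : ℝ) (x y : box d L) :
    P.corr L t (posOp x) (posOp y) = ((P.muSqrt L x * P.muSqrt L y / 2 : ℝ) : ℂ) *
      matFun (P.h_isHermitian L) (fun s => ((s ^ (-1 / 2 : ℝ) : ℝ) : ℂ) * phase t s) x y := by
  obtain ⟨Φ, h1, h2⟩ := ((P.exists_mem_dynOp_graph L hm hpd).2.2 t x y).1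
  exact (expectation_of_mem_graph h1).trans h2

theorem corr_pos_mom (hm : ∀ x, 0 < P.m x) (hpd : (P.h0 L).PosDef) (t : ℝ) (x y : box d L) :
    P.corr L t (posOp x) (momOp y) = (Complex.I * (P.muSqrt L x / P.muSqrt L y / 2 : ℝ)) *
      matFun (P.h_isHermitian L) (fun s => ((s ^ (0 : ℝ) : ℝ) : ℂ) * phase t s) x y := by
  obtain ⟨Φ, h1, h2⟩ := ((P.exists_mem_dynOp_graph L hm hpd).2.2 t x y).2.1
  exact (expectation_of_mem_graph h1).trans h2

theorem corr_mom_pos (hm : ∀ x, 0 < P.m x) (hpd : (P.h0 L).PosDef) (t : ℝ) (x y : box d L) :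
    P.corr L t (momOp x) (posOp y) = (-Complex.I * (P.muSqrt L y / P.muSqrt L x / 2 : ℝ)) *
      matFun (P.h_isHermitian L) (fun s => ((s ^ (0 : ℝ) : ℝ) : ℂ) * phase t s) x y := by
  obtain ⟨Φ, h1, h2⟩ := ((P.exists_mem_dynOp_graph L hm hpd).2.2 t x y).2.2.1
  exact (expectation_of_mem_graph h1).trans h2

theorem corr_mom_mom (hm : ∀ x, 0 < P.m x) (hpd : (P.h0 L).PosDef) (t : ℝ) (x y : box d L) :
    P.corr L t (momOp x) (momOp y) = ((1 / (P.muSqrt L x * P.muSqrt L y) / 2 : ℝ) : ℂ) *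
      matFun (P.h_isHermitian L) (fun s => ((Real.sqrt s : ℝ) : ℂ) * phase t s) x y := by
  obtain ⟨Φ, h1, h2⟩ := ((P.exists_mem_dynOp_graph L hm hpd).2.2 t x y).2.2.2
  exact (expectation_of_mem_graph h1).trans h2

/-! ### Bounds by eigenfunction correlators -/

theorem enorm_matFun_le_efc (α r : ℝ) {u : ℝ → ℂ} (hu : ∀ s, ‖u s‖ ≤ 1) (x y : box d L) :
    ‖matFun (P.h_isHermitian L) (fun s => ((s ^ α : ℝ) : ℂ) * u s) x y‖ₑ ^ r ≤
      P.efc L α r x y :=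
  le_iSup (fun u : {u : ℝ → ℂ // ∀ s, ‖u s‖ ≤ 1} =>
    ‖matFun (P.h_isHermitian L) (fun s => ((s ^ α : ℝ) : ℂ) * u.1 s) x y‖ₑ ^ r) ⟨u, hu⟩

variable {mmin mmax kmax lammax : ℝ}

theorem Bounded.muSqrt_le (hb : P.Bounded mmin mmax kmax lammax) (hmmin : 0 < mmin) (x : box d L) :
    P.muSqrt L x ≤ Real.sqrt (1 / (2 * mmin)) := by
  have := hb.m_pos hmmin x
  unfold muSqrt
  gcongr
  exact (hb.1 x).1

theorem Bounded.inv_muSqrt_le (hb : P.Bounded mmin mmax kmax lammax) (x : box d L) :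
    (P.muSqrt L x)⁻¹ ≤ Real.sqrt (2 * mmax) := by
  rw [muSqrt, one_div, Real.sqrt_inv, inv_inv]
  gcongr
  exact (hb.1 x).2

theorem muSqrt_nonneg (x : box d L) : 0 ≤ P.muSqrt L x := Real.sqrt_nonneg _

theorem Bounded.enorm_corr_pos_pos_le (hb : P.Bounded mmin mmax kmax lammax) (hmmin : 0 < mmin)
    (hpd : (P.h0 L).PosDef) {r : ℝ} (hr : 0 < r) (t : ℝ) (x y : box d L) :
    ‖P.corr L t (posOp x) (posOp y)‖ₑ ^ r ≤
      ENNReal.ofReal ((1 / (2 * mmin) / 2) ^ r) * P.efc L (-1 / 2) r x y := by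
  rw [corr_pos_pos (hb.m_pos hmmin) hpd, enorm_mul, ENNReal.mul_rpow_of_nonneg _ _ hr.le]
  refine mul_le_mul' ?_ (enorm_matFun_le_efc _ _ (fun s => (norm_phase t s).le) x y)
  rw [← ENNReal.ofReal_rpow_of_nonneg (by positivity) hr.le]
  refine ENNReal.rpow_le_rpow ?_ hr.le
  rw [← ofReal_norm, Complex.norm_real]
  refine ENNReal.ofReal_le_ofReal ?_
  have h1 := hb.muSqrt_le hmmin x
  have h2 := hb.muSqrt_le hmmin y
  rw [Real.norm_of_nonneg (div_nonneg (mul_nonneg (muSqrt_nonneg x) (muSqrt_nonneg y)) zero_le_two)]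
  have h3 : Real.sqrt (1 / (2 * mmin)) * Real.sqrt (1 / (2 * mmin)) = 1 / (2 * mmin) :=
    Real.mul_self_sqrt (by positivity)
  rw [← h3]
  gcongr
  exact muSqrt_nonneg y

theorem enorm_mul_le_of_norm_le {c z : ℂ} {K : ℝ} {M : ℝ≥0∞} (hc : ‖c‖ ≤ K)
    (hz : ‖z‖ₑ ^ (1 : ℝ) ≤ M) : ‖c * z‖ₑ ≤ ENNReal.ofReal K * M := by
  rw [enorm_mul]
  rw [ENNReal.rpow_one] at hz
  refine mul_le_mul' ?_ hz
  rw [← ofReal_norm]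
  exact ENNReal.ofReal_le_ofReal hc

/-- The constant adds the bound for the mixed correlations to the one for momentum-momentum, where
`√h` costs the extra factor `√specBound`. -/
theorem Bounded.enorm_corr_le (hb : P.Bounded mmin mmax kmax lammax) (hmmin : 0 < mmin)
    (hpd : (P.h0 L).PosDef) (t : ℝ) (x y : box d L) :
    max ‖P.corr L t (momOp x) (posOp y)‖ₑ (max ‖P.corr L t (posOp x) (momOp y)‖ₑ
      ‖P.corr L t (momOp x) (momOp y)‖ₑ) ≤
      ENNReal.ofReal (Real.sqrt (1 / (2 * mmin)) * Real.sqrt (2 * mmax) / 2 +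
        Real.sqrt (2 * mmax) * Real.sqrt (2 * mmax) / 2 *
          Real.sqrt (specBound d mmin kmax lammax)) * P.efc L 0 1 x y := by
  have hm := hb.m_pos hmmin
  have hS := Real.sqrt_pos.2 (specBound_pos (d := d) (kmax := kmax) (lammax := lammax) hmmin)
  have hx := hb.muSqrt_le hmmin x
  have hy := hb.muSqrt_le hmmin y
  have hx' := hb.inv_muSqrt_le x
  have hy' := hb.inv_muSqrt_le y
  have hx0 : 0 ≤ P.muSqrt L x := muSqrt_nonneg x
  have hy0 : 0 ≤ P.muSqrt L y := muSqrt_nonneg y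
  set S := Real.sqrt (specBound d mmin kmax lammax)
  have hn1 : ∀ {a b : ℝ}, 0 ≤ a → 0 ≤ b → a ≤ Real.sqrt (1 / (2 * mmin)) →
      b⁻¹ ≤ Real.sqrt (2 * mmax) → |a / b / 2| ≤
        Real.sqrt (1 / (2 * mmin)) * Real.sqrt (2 * mmax) / 2 +
        Real.sqrt (2 * mmax) * Real.sqrt (2 * mmax) / 2 * S := by
    intro a b ha hb0 h1 h2
    rw [abs_of_nonneg (by positivity), div_eq_mul_inv a b]
    have : a * b⁻¹ / 2 ≤ Real.sqrt (1 / (2 * mmin)) * Real.sqrt (2 * mmax) / 2 := by gcongr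
    have h3 : 0 ≤ Real.sqrt (2 * mmax) * Real.sqrt (2 * mmax) / 2 * S := by positivity
    linarith
  refine max_le ?_ (max_le ?_ ?_)
  · rw [corr_mom_pos hm hpd]
    refine enorm_mul_le_of_norm_le ?_
      (enorm_matFun_le_efc 0 1 (fun s => (norm_phase t s).le) x y)
    rw [norm_mul, norm_neg, Complex.norm_I, one_mul, Complex.norm_real, Real.norm_eq_abs]
    exact hn1 hy0 hx0 hy hx'
  · rw [corr_pos_mom hm hpd]
    refine enorm_mul_le_of_norm_le ?_
      (enorm_matFun_le_efc 0 1 (fun s => (norm_phase t s).le) x y)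
    rw [norm_mul, Complex.norm_I, one_mul, Complex.norm_real, Real.norm_eq_abs]
    exact hn1 hx0 hy0 hx hy'
  · rw [corr_mom_mom hm hpd]
    -- The correlator requires `|u| ≤ 1` on all of `ℝ`; the cutoff lies above the spectrum and so
    -- does not change the matrix.
    set u : ℝ → ℂ := fun s => if s ≤ specBound d mmin kmax lammax then
      ((Real.sqrt s / S : ℝ) : ℂ) * phase t s else 0 with hu_def
    have hu : ∀ s, ‖u s‖ ≤ 1 := by
      intro s
      simp only [hu_def]
      split_ifs with hs
      · rw [norm_mul, norm_phase, mul_one, Complex.norm_real,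
          Real.norm_of_nonneg (by positivity), div_le_one hS]
        exact Real.sqrt_le_sqrt hs
      · simp
    have hmat : matFun (P.h_isHermitian L) (fun s => ((Real.sqrt s : ℝ) : ℂ) * phase t s) x y =
        (S : ℂ) * matFun (P.h_isHermitian L) (fun s => ((s ^ (0 : ℝ) : ℝ) : ℂ) * u s) x y := by
      rw [← matFun_const_mul]
      refine matFun_congr _ (fun k => ?_) x y
      simp only [hu_def, if_pos (hb.eigenvalues_le hmmin k), Real.rpow_zero]
      have : (S : ℂ) ≠ 0 := by exact_mod_cast hS.ne'
      push_cast
      field_simp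
    rw [hmat, ← mul_assoc]
    refine enorm_mul_le_of_norm_le ?_ (enorm_matFun_le_efc 0 1 hu x y)
    rw [← Complex.ofReal_mul, Complex.norm_real, Real.norm_of_nonneg (by positivity), one_div,
      mul_inv]
    have : (P.muSqrt L x)⁻¹ * (P.muSqrt L y)⁻¹ / 2 * S ≤
        Real.sqrt (2 * mmax) * Real.sqrt (2 * mmax) / 2 * S := by gcongr
    have h3 : 0 ≤ Real.sqrt (1 / (2 * mmin)) * Real.sqrt (2 * mmax) / 2 := by positivity
    linarith

end Params

/-! ### Measurability of the correlations -/

section Random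

variable {Ω : Type*} [MeasurableSpace Ω] {ℙ : Measure Ω} {d : ℕ} {P : Ω → Params d} {L : ℕ}

theorem measurable_muSqrt (hm : ∀ x, Measurable fun ω => (P ω).m x) (x : box d L) :
    Measurable fun ω => (P ω).muSqrt L x :=
  (measurable_const.div ((hm x).const_mul 2)).sqrt

theorem measurable_h (hm : ∀ x, Measurable fun ω => (P ω).m x)
    (hk : ∀ x, Measurable fun ω => (P ω).k x)
    (hlam : ∀ x y, dist1 x y = 1 → Measurable fun ω => (P ω).lam s(x, y)) (x y : box d L) :
    Measurable fun ω => (P ω).h L x y := by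
  have hc : ∀ x y : box d L, Measurable fun ω => (P ω).coupling L x y := by
    intro x y
    by_cases hxy : dist1 x.1 y.1 = 1
    · simpa only [Params.coupling, if_pos hxy] using hlam _ _ hxy
    · simpa only [Params.coupling, if_neg hxy] using measurable_const
  have h0 : Measurable fun ω => (P ω).h0 L x y := by
    simp only [Params.h0_apply]
    refine Measurable.sub ?_ (hc x y)
    by_cases hxy : x = y
    · simp only [if_pos hxy]
      exact ((hk x).div_const 2).add (Finset.measurable_sum _ fun u _ => hc x u)
    · simp only [if_neg hxy]
      exact measurable_const
  simp only [Params.h_apply]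
  exact ((measurable_muSqrt hm x).mul h0).mul (measurable_muSqrt hm y)

/-- A random variable of the form `c(ω) ⟨δ_x, f(h) e^{-2it√h} δ_y⟩` is measurable. -/
theorem aemeasurable_mul_matFun (hh : ∀ x y : box d L, Measurable fun ω => (P ω).h L x y)
    (hpos : ∀ᵐ ω ∂ℙ, ∀ k, 0 < ((P ω).h_isHermitian L).eigenvalues k) {c : Ω → ℂ}
    (hc : Measurable c) {f : ℝ → ℂ} (hf : ContinuousOn f (Set.Ioi 0)) (t : ℝ) (x y : box d L) :
    AEMeasurable (fun ω => c ω *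
      matFun ((P ω).h_isHermitian L) (fun s => f s * phase t s) x y) ℙ :=
  hc.aemeasurable.mul (aemeasurable_matFun hh (fun ω => (P ω).h_isHermitian L) hpos
    (hf.mul (continuous_phase_right t).continuousOn) x y)

theorem continuousOn_rpow_ofReal (α : ℝ) :
    ContinuousOn (fun s : ℝ => ((s ^ α : ℝ) : ℂ)) (Set.Ioi 0) :=
  Complex.continuous_ofReal.comp_continuousOn
    (continuousOn_id.rpow_const fun _ hs => Or.inl (ne_of_gt hs))

/-- Exponential bounds are inherited from almost sure bounds by an eigenfunction correlator. -/
theorem lintegral_le_of_le_efc {α r C η K : ℝ} (hK : 0 ≤ K) {x y : box d L}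
    (hC : ∫⁻ ω, (P ω).efc L α r x y ∂ℙ ≤ ENNReal.ofReal (C * Real.exp (-η * dist1 x.1 y.1)))
    {F : Ω → ℝ≥0∞} (hF : ∀ᵐ ω ∂ℙ, F ω ≤ ENNReal.ofReal K * (P ω).efc L α r x y) :
    ∫⁻ ω, F ω ∂ℙ ≤ ENNReal.ofReal (K * C * Real.exp (-η * dist1 x.1 y.1)) := by
  refine (lintegral_mono_ae hF).trans ?_
  -- Finiteness of the constant suffices to pull it out; measurability of `efc`, an uncountable
  -- supremum, is not needed.
  rw [lintegral_const_mul' _ _ ENNReal.ofReal_ne_top, mul_assoc, ENNReal.ofReal_mul hK]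
  gcongr

end Random

end Oscillator

end

/-! ### Exponential decay of the dynamic ground state correlations. -/

theorem theorem4p3 {Ω : Type*} [MeasurableSpace Ω] (ℙ : Measure Ω) [IsProbabilityMeasure ℙ]
    (d : ℕ) (hd : 1 ≤ d) (P : Ω → Params d)
    (hm : ∀ x, Measurable fun ω => (P ω).m x)
    (hk : ∀ x, Measurable fun ω => (P ω).k x)
    (hlam : ∀ x y, dist1 x y = 1 → Measurable fun ω => (P ω).lam s(x, y))
    (mmin mmax kmax lammax : ℝ) (hmmin : 0 < mmin)
    (hA1 : ∀ᵐ ω ∂ℙ, (P ω).Bounded mmin mmax kmax lammax)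
    (hA2 : ∀ᵐ ω ∂ℙ, ∀ L : ℕ, 1 ≤ L → ((P ω).h0 L).PosDef) :
    -- the ground state exists, is unique up to a phase, and lies in the domains of the
    -- operators whose expectations are considered
    (∀ᵐ ω ∂ℙ, ∀ L : ℕ, 1 ≤ L →
      IsGroundState ((P ω).hamiltonian L) ((P ω).gs L) ∧
      (∀ Ψ, IsGroundState ((P ω).hamiltonian L) Ψ → ∃ c : ℂ, ‖c‖ = 1 ∧ Ψ = c • (P ω).gs L) ∧
      ∀ (t : ℝ) (x y : box d L),
        (P ω).gs L ∈ ((P ω).dynOp L t (posOp x) (posOp y)).domain ∧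
        (P ω).gs L ∈ ((P ω).dynOp L t (posOp x) (momOp y)).domain ∧
        (P ω).gs L ∈ ((P ω).dynOp L t (momOp x) (posOp y)).domain ∧
        (P ω).gs L ∈ ((P ω).dynOp L t (momOp x) (momOp y)).domain) ∧
    -- (a)
    (∀ r : ℝ, 0 < r → r ≤ 1 → ExpDecayEFC ℙ P (-1 / 2) r →
      ∃ C' μ' : ℝ, 0 < μ' ∧ ∀ L : ℕ, 1 ≤ L → ∀ x y : box d L,
        AEMeasurable (fun ω => ⨆ t : ℝ, ‖(P ω).corr L t (posOp x) (posOp y)‖ₑ ^ r) ℙ ∧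
        ∫⁻ ω, ⨆ t : ℝ, ‖(P ω).corr L t (posOp x) (posOp y)‖ₑ ^ r ∂ℙ
          ≤ ENNReal.ofReal (C' * Real.exp (-μ' * dist1 x.1 y.1))) ∧
    -- (b)
    (ExpDecayEFC ℙ P 0 1 →
      ∃ C' μ' : ℝ, 0 < μ' ∧ ∀ L : ℕ, 1 ≤ L → ∀ x y : box d L,
        AEMeasurable (fun ω => ⨆ t : ℝ, max ‖(P ω).corr L t (momOp x) (posOp y)‖ₑ
          (max ‖(P ω).corr L t (posOp x) (momOp y)‖ₑ
            ‖(P ω).corr L t (momOp x) (momOp y)‖ₑ)) ℙ ∧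
        ∫⁻ ω, ⨆ t : ℝ, max ‖(P ω).corr L t (momOp x) (posOp y)‖ₑ
          (max ‖(P ω).corr L t (posOp x) (momOp y)‖ₑ
            ‖(P ω).corr L t (momOp x) (momOp y)‖ₑ) ∂ℙ
          ≤ ENNReal.ofReal (C' * Real.exp (-μ' * dist1 x.1 y.1))) := by
  have hgood : ∀ᵐ ω ∂ℙ, (P ω).Bounded mmin mmax kmax lammax ∧
      ∀ L : ℕ, 1 ≤ L → ((P ω).h0 L).PosDef := hA1.and hA2
  have hpos : ∀ L : ℕ, 1 ≤ L → ∀ᵐ ω ∂ℙ, ∀ k, 0 < ((P ω).h_isHermitian L).eigenvalues k := by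
    intro L hL
    filter_upwards [hgood] with ω hω
    exact (P ω).eigenvalues_pos L (hω.1.m_pos hmmin) (hω.2 L hL)
  have hsqrt : Continuous fun s : ℝ => ((Real.sqrt s : ℝ) : ℂ) :=
    Complex.continuous_ofReal.comp Real.continuous_sqrt
  refine ⟨?_, ?_, ?_⟩
  · filter_upwards [hgood] with ω hω L hL
    obtain ⟨h1, h2, h3⟩ :=
      (P ω).exists_mem_dynOp_graph L (hω.1.m_pos hmmin) (hω.2 L hL)
    refine ⟨h1, h2, fun t x y => ?_⟩
    obtain ⟨⟨_, g1, -⟩, ⟨_, g2, -⟩, ⟨_, g3, -⟩, ⟨_, g4, -⟩⟩ := h3 t x y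
    exact ⟨mem_domain_of_mem_graph g1, mem_domain_of_mem_graph g2, mem_domain_of_mem_graph g3,
      mem_domain_of_mem_graph g4⟩
  · rintro r hr - ⟨C, η, hη, hC⟩
    refine ⟨(1 / (2 * mmin) / 2) ^ r * C, η, hη, fun L hL x y => ⟨?_, ?_⟩⟩
    · refine aemeasurable_iSup_real (fun t => AEMeasurable.pow_const ?_ r) ?_
      · refine AEMeasurable.enorm ?_
        -- `corr` is built from a chosen ground state and is measurable only through its almost sure
        -- agreement with the explicit matrix formula.
        refine (aemeasurable_mul_matFun (measurable_h hm hk hlam) (hpos L hL)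
          (Complex.measurable_ofReal.comp
            (((measurable_muSqrt hm x).mul (measurable_muSqrt hm y)).div_const 2))
          (continuousOn_rpow_ofReal (-1 / 2)) t x y).congr ?_
        filter_upwards [hgood] with ω hω
        exact (Params.corr_pos_pos (hω.1.m_pos hmmin) (hω.2 L hL) t x y).symm
      · filter_upwards [hgood] with ω hω
        simp only [Params.corr_pos_pos (hω.1.m_pos hmmin) (hω.2 L hL)]
        exact (ENNReal.continuous_rpow_const).comp
          (continuous_const.mul (continuous_matFun_phase _ _ x y)).enorm
    · refine lintegral_le_of_le_efc (by positivity) (hC L hL x y) ?_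
      filter_upwards [hgood] with ω hω
      exact iSup_le fun t => hω.1.enorm_corr_pos_pos_le hmmin (hω.2 L hL) hr t x y
  · rintro ⟨C, η, hη, hC⟩
    refine ⟨(Real.sqrt (1 / (2 * mmin)) * Real.sqrt (2 * mmax) / 2 +
      Real.sqrt (2 * mmax) * Real.sqrt (2 * mmax) / 2 *
        Real.sqrt (Params.specBound d mmin kmax lammax)) * C, η, hη, fun L hL x y => ⟨?_, ?_⟩⟩
    · have hx := measurable_muSqrt (L := L) hm x
      have hy := measurable_muSqrt (L := L) hm y
      refine aemeasurable_iSup_real (fun t => ?_) ?_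
      · refine AEMeasurable.max ?_ (AEMeasurable.max ?_ ?_)
        · refine AEMeasurable.enorm ((aemeasurable_mul_matFun (measurable_h hm hk hlam)
            (hpos L hL) ((Complex.measurable_ofReal.comp
              ((hy.div hx).div_const 2)).const_mul (-Complex.I))
            (continuousOn_rpow_ofReal 0) t x y).congr ?_)
          filter_upwards [hgood] with ω hω
          exact (Params.corr_mom_pos (hω.1.m_pos hmmin) (hω.2 L hL) t x y).symm
        · refine AEMeasurable.enorm ((aemeasurable_mul_matFun (measurable_h hm hk hlam)
            (hpos L hL) ((Complex.measurable_ofReal.comp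
              ((hx.div hy).div_const 2)).const_mul Complex.I)
            (continuousOn_rpow_ofReal 0) t x y).congr ?_)
          filter_upwards [hgood] with ω hω
          exact (Params.corr_pos_mom (hω.1.m_pos hmmin) (hω.2 L hL) t x y).symm
        · refine AEMeasurable.enorm ((aemeasurable_mul_matFun (measurable_h hm hk hlam)
            (hpos L hL) (Complex.measurable_ofReal.comp
              (((measurable_const (a := (1 : ℝ))).div (hx.mul hy)).div_const 2))
            hsqrt.continuousOn t x y).congr ?_)
          filter_upwards [hgood] with ω hω
          exact (Params.corr_mom_mom (hω.1.m_pos hmmin) (hω.2 L hL) t x y).symm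
      · filter_upwards [hgood] with ω hω
        simp only [Params.corr_mom_pos (hω.1.m_pos hmmin) (hω.2 L hL),
          Params.corr_pos_mom (hω.1.m_pos hmmin) (hω.2 L hL),
          Params.corr_mom_mom (hω.1.m_pos hmmin) (hω.2 L hL)]
        exact ((continuous_const.mul (continuous_matFun_phase _ _ x y)).enorm).max
          (((continuous_const.mul (continuous_matFun_phase _ _ x y)).enorm).max
            (continuous_const.mul (continuous_matFun_phase _ _ x y)).enorm)
    · refine lintegral_le_of_le_efc (by positivity) (hC L hL x y) ?_
      filter_upwards [hgood] with ω hω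
      exact iSup_le fun t => hω.1.enorm_corr_le hmmin (hω.2 L hL) t x y
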